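/- Let $\mathbb{R}^{2,1}$ be $\mathbb{R}^3$ with $\langle u,v\rangle=u_1v_1+u_2v_2-u_3v_3$ and $\|v\|=\sqrt{|\langle v,v\rangle|}$. For an oriented smooth surface $M\subset\mathbb{R}^{2,1}$ let $I$ be the (possibly degenerate) induced form, let the tropic $LD$ be the set of points where $I$ is degenerate, and off $LD$ let $N$ be the unit normal with $\det(X_u,X_v,N)>0$ for positively oriented tangent bases $(X_u,X_v)$, $II(w,w')=-\langle dN(w),w'\rangle$, and $k_1\ge k_2$ the (real) eigenvalues of $-dN$. Multiplying $II$ by the length $\|X_u\times X_v\|$ of the normal, the equation $(Fg-Gf)\,dv^2+(Eg-Ge)\,du\,dv+(Ef-Fe)\,du^2=0$ of principal directions extends to $LD$, as does the notion of an umbilic point (a point where $II$, so rescaled, is a multiple of $I$). Let $\mathcal U$ be the set of umbilic points and $LPL$ the set of points with exactly one principal direction. Let $\mathcal F_1,\mathcal F_2$ be the principal foliations of $M\setminus(\mathcal U\cup LPL)$: their leaves are the maximal integral curves of the line fields of eigendirections of $k_1$, $k_2$ respectively, extended to $LD$ by continuity. The principal configuration of $M$ is $\mathbb P_M=\{\mathcal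 F_1,\mathcal F_2,\mathcal U,LD,LPL\}$. An ellipsoid is the zero set $\mathcal{S}$ of a polynomial $q$ of degree two on $\mathbb{R}^3$ with positive definite quadratic part that takes a negative value, oriented by the outer side $q>0$; it may be in any position. A semi-axis of $\mathcal{S}$ is a vector $v$ such that, $o$ being the center, $o+v\in\mathcal{S}$ and $v$ is orthogonal with respect to $\langle\cdot,\cdot\rangle$ to the tangent plane of $\mathcal{S}$ at $o+v$; the ellipsoid has three distinct axes if the set of lengths $\|v\|$ of its semi-axes has exactly three elements (for $x^2/a^2+y^2/b^2+z^2/c^2=1$ with $a,b,c>0$: if $a,b,c$ are pairwise distinct). Theorem. Let $M_1,M_2\subset\mathbb{R}^{2,1}$ be any two ellipsoids with three distinct axes. Then their principal configurations are $C^0$-principally equivalent: there is a homeomorphism $h:M_1\to M_2$ that maps the leaves of $\mathcal F_1$ and of $\mathcal F_2$ of $M_1$ onto the leaves of $\mathcal F_1$ and of $\mathcal F_2$ of $M_2$ respectively, and that maps $\mathcal U$, $LD$ and $LPL$ of $M_1$ onto $\mathcal U$, $LD$ and $LPL$ of $M_2$. -/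

import Mathlib

open scoped ContDiff

namespace Minkowski

noncomputable section

/-- The vector space underlying `ℝ^{2,1}`. -/
abbrev Space : Type := Fin 3 → ℝ

/-- The Lorentzian inner product `⟨u, v⟩ = u₁ v₁ + u₂ v₂ - u₃ v₃`. -/
def inn (u v : Space) : ℝ := u 0 * v 0 + u 1 * v 1 - u 2 * v 2

/-- The Minkowski norm `‖v‖ = √|⟨v, v⟩|`. -/
def mnorm (v : Space) : ℝ := Real.sqrt |inn v v|

/-! ### Surfaces

A surface is the zero set of a smooth function `φ` whose differential does not vanish on it,
oriented by the side `0 < φ`. -/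

/-- The zero set of `φ`. -/
def zeroSet (φ : Space → ℝ) : Set Space := {p | φ p = 0}

/-- `w` is tangent at `p` to the level surface of `φ`. -/
def IsTangent (φ : Space → ℝ) (p w : Space) : Prop := fderiv ℝ φ p w = 0

/-- The Lorentzian gradient `ν` of `φ`, that is `⟨ν p, w⟩ = dφ_p w` for all `w`. -/
def grad (φ : Space → ℝ) (p : Space) : Space :=
  ![fderiv ℝ φ p (Pi.single 0 1), fderiv ℝ φ p (Pi.single 1 1),
    -fderiv ℝ φ p (Pi.single 2 1)]

theorem inn_grad (φ : Space → ℝ) (p w : Space) : inn (grad φ p) w = fderiv ℝ φ p w := by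
  have hw : w = w 0 • Pi.single 0 1 + w 1 • Pi.single 1 1 + w 2 • (Pi.single 2 1 : Space) := by
    ext i; fin_cases i <;> simp
  conv_rhs => rw [hw]
  simp only [map_add, map_smul, smul_eq_mul, inn, grad, Matrix.cons_val_zero, Matrix.cons_val_one,
    Matrix.cons_val]
  ring

/-- The Gauss map `N = ε ν / ‖ν‖`, where `ε = ±1` is the sign of `⟨ν, ν⟩`. For a tangent basis
`α_u, α_v` whose Lorentzian vector product is a positive multiple of `ν`, this is the choice of
sign with `det (α_u, α_v, N) > 0`. It is meaningful where `⟨ν, ν⟩ ≠ 0`. -/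
def gaussMap (φ : Space → ℝ) (p : Space) : Space :=
  ((SignType.sign (inn (grad φ p) (grad φ p)) : ℝ) / mnorm (grad φ p)) • grad φ p

/-- The second fundamental form `II (w, w') = -⟨dN w, w'⟩`, off the tropic. (The first fundamental
form is the restriction of `inn` to tangent vectors.) -/
def secondForm (φ : Space → ℝ) (p w w' : Space) : ℝ :=
  -inn (fderiv ℝ (gaussMap φ) p w) w'

/-- The second fundamental form with respect to the normal `ν` that is not normalized. On tangent
vectors it is `± ‖ν‖ II` off the tropic, and it makes sense on the tropic as well. -/
def weightedForm (φ : Space → ℝ) (p w w' : Space) : ℝ :=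
  -inn (fderiv ℝ (grad φ) p w) w'

/-- `w` is a nonzero tangent vector that satisfies the equation of curvature lines, extended to the
tropic. If `w = du X_u + dv X_v`, the equation for `w₁ = X_u`, `w₂ = X_v` reads
`(F g - G f) dv² + (E g - G e) du dv + (E f - F e) du² = 0`, with `e, f, g` the coefficients of
the weighted form. -/
def IsPrincipalDirection (φ : Space → ℝ) (p w : Space) : Prop :=
  w ≠ 0 ∧ IsTangent φ p w ∧ ∀ w₁ w₂, IsTangent φ p w₁ → IsTangent φ p w₂ →
    inn w w₁ * weightedForm φ p w w₂ = inn w w₂ * weightedForm φ p w w₁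

/-- The set of umbilic points: the second fundamental form is a multiple of the first. -/
def umbilicSet (φ : Space → ℝ) : Set Space :=
  {p | p ∈ zeroSet φ ∧ ∃ c : ℝ, ∀ w w', IsTangent φ p w → IsTangent φ p w' →
    weightedForm φ p w w' = c * inn w w'}

/-- The tropic `LD`: the points where the induced metric is degenerate. -/
def tropic (φ : Space → ℝ) : Set Space :=
  {p | p ∈ zeroSet φ ∧ ∃ w, w ≠ 0 ∧ IsTangent φ p w ∧ ∀ w', IsTangent φ p w' → inn w w' = 0}

/-- The set `LPL`: the points with exactly one principal direction. -/
def lightlikePrincipalLocus (φ : Space → ℝ) : Set Space :=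
  {p | p ∈ zeroSet φ ∧ ∃ w, IsPrincipalDirection φ p w ∧
    ∀ w', IsPrincipalDirection φ p w' → ∃ s : ℝ, w' = s • w}

/-- The points of the surface through which the principal foliations are considered. -/
def regularPart (φ : Space → ℝ) : Set Space :=
  zeroSet φ \ (umbilicSet φ ∪ lightlikePrincipalLocus φ)

/-- `w` is a nonzero tangent vector with `II (w, ·) = k I (w, ·)`, that is `-dN w = k w`. -/
def IsCurvatureVector (φ : Space → ℝ) (p : Space) (k : ℝ) (w : Space) : Prop :=
  w ≠ 0 ∧ IsTangent φ p w ∧ ∀ w', IsTangent φ p w' → secondForm φ p w w' = k * inn w w'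

/-- `k` is a principal curvature at `p`. -/
def IsPrincipalCurvature (φ : Space → ℝ) (p : Space) (k : ℝ) : Prop :=
  ∃ w, IsCurvatureVector φ p k w

/-- The larger principal curvature is `k₁`. -/
def IsFirstCurvature (φ : Space → ℝ) (p : Space) (k : ℝ) : Prop :=
  IsGreatest {k' | IsPrincipalCurvature φ p k'} k

/-- The smaller principal curvature is `k₂`. -/
def IsSecondCurvature (φ : Space → ℝ) (p : Space) (k : ℝ) : Prop :=
  IsLeast {k' | IsPrincipalCurvature φ p k'} k

/-- The principal line fields off the tropic, as sets of pairs (point, nonzero vector):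
`i = 0` belongs to `k₁` and `i = 1` to `k₂`. -/
def lineFieldOff (φ : Space → ℝ) (i : Fin 2) : Set (Space × Space) :=
  {x | x.1 ∈ regularPart φ ∧ x.1 ∉ tropic φ ∧
    ∃ k, (if i = 0 then IsFirstCurvature φ x.1 k else IsSecondCurvature φ x.1 k) ∧
      IsCurvatureVector φ x.1 k x.2}

/-- The principal line fields `𝓛₁`, `𝓛₂`, extended to the tropic by passing to the limit. -/
def lineField (φ : Space → ℝ) (i : Fin 2) : Set (Space × Space) :=
  lineFieldOff φ i ∪
    {x | x.1 ∈ regularPart φ ∧ x.1 ∈ tropic φ ∧ x.2 ≠ 0 ∧ x ∈ closure (lineFieldOff φ i)}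

/-- A smooth regular integral curve, on the interval `(s, t)`, of a principal line field. -/
def IsPrincipalCurve (φ : Space → ℝ) (i : Fin 2) (γ : ℝ → Space) (s t : ℝ) : Prop :=
  ContDiffOn ℝ ∞ γ (Set.Ioo s t) ∧ ∀ τ ∈ Set.Ioo s t, (γ τ, deriv γ τ) ∈ lineField φ i

/-- The maximal principal line through `p`: the union of all integral curves through `p`. -/
def leaf (φ : Space → ℝ) (i : Fin 2) (p : Space) : Set Space :=
  {q | ∃ (γ : ℝ → Space) (s t : ℝ), IsPrincipalCurve φ i γ s t ∧
    p ∈ γ '' Set.Ioo s t ∧ q ∈ γ '' Set.Ioo s t}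

/-- A principal foliation, as the set of its leaves. -/
def foliation (φ : Space → ℝ) (i : Fin 2) : Set (Set Space) :=
  {A | ∃ p ∈ A, A = leaf φ i p}

/-- The quintuple `{𝓕₁, 𝓕₂, 𝓤, LD, LPL}`, with the surface that carries it. -/
structure PrincipalConfiguration where
  surface : Set Space
  F₁ : Set (Set Space)
  F₂ : Set (Set Space)
  U : Set Space
  LD : Set Space
  LPL : Set Space

/-- The principal configuration of the surface `φ = 0`. -/
def principalConfiguration (φ : Space → ℝ) : PrincipalConfiguration where
  surface := zeroSet φ
  F₁ := foliation φ 0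
  F₂ := foliation φ 1
  U := umbilicSet φ
  LD := tropic φ
  LPL := lightlikePrincipalLocus φ

/-- The image under `h : M₁ → M₂` of a subset of `M₁`. -/
def mapSet {M₁ M₂ : Set Space} (h : M₁ ≃ₜ M₂) (A : Set Space) : Set Space :=
  {q | ∃ p : M₁, (p : Space) ∈ A ∧ (h p : Space) = q}

/-- `C⁰`-principal equivalence of principal configurations. -/
def PrincipallyEquivalent (P₁ P₂ : PrincipalConfiguration) : Prop :=
  ∃ h : P₁.surface ≃ₜ P₂.surface,
    mapSet h '' P₁.F₁ = P₂.F₁ ∧ mapSet h '' P₁.F₂ = P₂.F₂ ∧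
    mapSet h P₁.U = P₂.U ∧ mapSet h P₁.LD = P₂.LD ∧ mapSet h P₁.LPL = P₂.LPL

/-! ### Ellipsoids -/

/-- A quadric
`a x² + b y² + c z² + 2 d x y + 2 e x z + 2 f y z + g x + h y + k z + l = 0` of `ℝ³`. -/
structure Quadric where
  a : ℝ
  b : ℝ
  c : ℝ
  d : ℝ
  e : ℝ
  f : ℝ
  g : ℝ
  h : ℝ
  k : ℝ
  l : ℝ

namespace Quadric

/-- The quadratic part. -/
def quad (Q : Quadric) (p : Space) : ℝ :=
  Q.a * p 0 ^ 2 + Q.b * p 1 ^ 2 + Q.c * p 2 ^ 2 +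
    2 * Q.d * p 0 * p 1 + 2 * Q.e * p 0 * p 2 + 2 * Q.f * p 1 * p 2

/-- The polynomial of the quadric. -/
def poly (Q : Quadric) (p : Space) : ℝ :=
  Q.quad p + Q.g * p 0 + Q.h * p 1 + Q.k * p 2 + Q.l

/-- The quadric is a (real, nondegenerate) ellipsoid: its quadratic part is positive definite, and
the polynomial takes a negative value, so that the zero set is neither empty nor one point. -/
def IsEllipsoid (Q : Quadric) : Prop :=
  (∀ v : Space, v ≠ 0 → 0 < Q.quad v) ∧ ∃ p, Q.poly p < 0

/-- `o` is a center of symmetry of the quadric. -/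
def IsCenter (Q : Quadric) (o : Space) : Prop :=
  ∀ v, Q.poly (o + v) = Q.poly (o - v)

/-- `v` is a semi-axis vector at the center `o`: `o + v` lies on the quadric, and `v` is normal
to the quadric there, with respect to the Lorentzian inner product. -/
def IsSemiAxis (Q : Quadric) (o v : Space) : Prop :=
  o + v ∈ zeroSet Q.poly ∧ ∀ w, IsTangent Q.poly (o + v) w → inn v w = 0

/-- The lengths of the semi-axes. For `x²/a² + y²/b² + z²/c² = 1` with `a, b, c > 0` they
are `a`, `b` and `c`. -/
def semiAxisLengths (Q : Quadric) : Set ℝ :=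
  {r | ∃ o v, Q.IsCenter o ∧ Q.IsSemiAxis o v ∧ r = mnorm v}

/-- The axes of the quadric have three distinct lengths. -/
def HasThreeDistinctAxes (Q : Quadric) : Prop := Q.semiAxisLengths.ncard = 3

end Quadric

end

end Minkowski

/-! Simultaneous diagonalization of the quadratic part of the polynomial and the Lorentzian product
gives affine coordinates in which the ellipsoid is the unit sphere and the induced form is the
restriction of diag(α, β, γ), with γ < 0 < β ≤ α. The signs come from the signature (2,1), and α ≠ β
from the three distinct axes (`exists_normalForm`). The gradient is affine in the point, so the
weighted second form becomes a constant multiple of the Euclidean product (`weightedForm_apply`).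
Thus the two forms exchange their usual roles: principal directions are the eigendirections of the
diagonal form on the planes tangent to the round sphere.

The eigenvalues `lamMin` ≤ β ≤ `lamMax` on a tangent plane are confocal coordinates on the sphere,
and with the signs of the coordinates they determine the point. A principal curvature is a factor
divided by an eigenvalue. The factor changes sign together with `lamMin` across the tropic, so k₁
always belongs to `lamMin` and k₂ to `lamMax` (`mem_lineFieldOff`), and the line fields extend
continuously (`mem_lineField`). Along an eigendirection the other eigenvalue is constant. A leaf is
therefore given by the value of that eigenvalue and the sign of one coordinate
(`exists_isEigCurve_iff`, `mem_leaf`). Umbilic points are those with `lamMin = lamMax`, the tropic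
is `lamMin = 0`, and `LPL` is empty.

Hence every ingredient is read off from two eigenvalues and three signs. Applying to both
eigenvalues an increasing map of the line with γ, 0, β, α ↦ γ', 0, β', α', and keeping the signs,
gives the homeomorphism (`sphereMap_spec`, `principallyEquivalent`). -/

namespace Minkowski

noncomputable section

/-! ### Principal directions of a diagonal form on the unit sphere -/

/-- The Euclidean inner product. -/
def dot (U V : Space) : ℝ := U 0 * V 0 + U 1 * V 1 + U 2 * V 2

/-- The diagonal bilinear form with coefficients `α, β, γ`. -/
def diagForm (α β γ : ℝ) (U V : Space) : ℝ :=
  α * U 0 * V 0 + β * U 1 * V 1 + γ * U 2 * V 2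

/-- The trace of the diagonal form on the plane orthogonal to the unit vector `X`. -/
def planeTrace (α β γ : ℝ) (X : Space) : ℝ :=
  (β + γ) * X 0 ^ 2 + (α + γ) * X 1 ^ 2 + (α + β) * X 2 ^ 2

/-- The determinant of the diagonal form on the plane orthogonal to the unit vector `X`. -/
def planeDet (α β γ : ℝ) (X : Space) : ℝ :=
  β * γ * X 0 ^ 2 + α * γ * X 1 ^ 2 + α * β * X 2 ^ 2

/-- The discriminant of the characteristic polynomial on the plane orthogonal to `X`. -/
def planeDisc (α β γ : ℝ) (X : Space) : ℝ :=
  planeTrace α β γ X ^ 2 - 4 * planeDet α β γ X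

/-- The larger eigenvalue of the diagonal form on the plane orthogonal to `X`. -/
def lamMax (α β γ : ℝ) (X : Space) : ℝ :=
  (planeTrace α β γ X + √(planeDisc α β γ X)) / 2

/-- The smaller eigenvalue of the diagonal form on the plane orthogonal to `X`. -/
def lamMin (α β γ : ℝ) (X : Space) : ℝ :=
  (planeTrace α β γ X - √(planeDisc α β γ X)) / 2

/-- `W` is an eigenvector, with eigenvalue `μ`, of the diagonal form on the plane orthogonal
to `X`. -/
def IsEig (α β γ : ℝ) (X : Space) (μ : ℝ) (W : Space) : Prop :=
  W ≠ 0 ∧ dot X W = 0 ∧ ∀ V, dot X V = 0 → diagForm α β γ W V = μ * dot W V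

/-- The vector product. -/
def cross (X W : Space) : Space :=
  ![X 1 * W 2 - X 2 * W 1, X 2 * W 0 - X 0 * W 2, X 0 * W 1 - X 1 * W 0]

theorem space_ext {U V : Space} (h0 : U 0 = V 0) (h1 : U 1 = V 1) (h2 : U 2 = V 2) : U = V := by
  ext i; fin_cases i <;> assumption

theorem dot_self_pos {W : Space} (hW : W ≠ 0) : 0 < dot W W := by
  by_contra h
  apply hW
  simp only [dot] at h
  apply space_ext <;> simp only [Pi.zero_apply] <;>
    nlinarith [sq_nonneg (W 0), sq_nonneg (W 1), sq_nonneg (W 2)]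

/-- Lagrange multipliers: the diagonal operator minus μ sends `W` to a normal vector of the plane,
that is to a multiple of `X`. -/
theorem isEig_iff {α β γ μ : ℝ} {X W : Space} (hX : dot X X = 1) :
    IsEig α β γ X μ W ↔ W ≠ 0 ∧ dot X W = 0 ∧ ∃ ρ, (α - μ) * W 0 = ρ * X 0 ∧
      (β - μ) * W 1 = ρ * X 1 ∧ (γ - μ) * W 2 = ρ * X 2 := by
  refine and_congr_right fun _ => and_congr_right fun h => ⟨fun H => ?_, ?_⟩
  -- The test vectors are the projections of the standard basis vectors to the plane orthogonal to
  -- `X`.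
  · refine ⟨diagForm α β γ W X, ?_, ?_, ?_⟩
    · have := H ![1 - X 0 * X 0, -X 0 * X 1, -X 0 * X 2] (by
        simp [dot] at hX ⊢; linear_combination (-X 0) * hX)
      simp [dot, diagForm] at this h ⊢
      linear_combination this - μ * X 0 * h
    · have := H ![-X 1 * X 0, 1 - X 1 * X 1, -X 1 * X 2] (by
        simp [dot] at hX ⊢; linear_combination (-X 1) * hX)
      simp [dot, diagForm] at this h ⊢
      linear_combination this - μ * X 1 * h
    · have := H ![-X 2 * X 0, -X 2 * X 1, 1 - X 2 * X 2] (by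
        simp [dot] at hX ⊢; linear_combination (-X 2) * hX)
      simp [dot, diagForm] at this h ⊢
      linear_combination this - μ * X 2 * h
  · rintro ⟨ρ, h0, h1, h2⟩ V hV
    simp only [dot, diagForm] at *
    linear_combination V 0 * h0 + V 1 * h1 + V 2 * h2 + ρ * hV

/-- For a unit vector the characteristic polynomial on the plane is X₀²(t-β)(t-γ) + X₁²(t-α)(t-γ) +
X₂²(t-α)(t-β). At a coefficient only one summand survives. -/
theorem charPoly_first {α β γ : ℝ} {X : Space} (hX : dot X X = 1) :
    α ^ 2 - planeTrace α β γ X * α + planeDet α β γ X = X 0 ^ 2 * ((α - β) * (α - γ)) := by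
  simp only [dot, planeTrace, planeDet] at *
  linear_combination -α ^ 2 * hX

theorem charPoly_second {α β γ : ℝ} {X : Space} (hX : dot X X = 1) :
    β ^ 2 - planeTrace α β γ X * β + planeDet α β γ X = X 1 ^ 2 * ((β - α) * (β - γ)) := by
  simp only [dot, planeTrace, planeDet] at *
  linear_combination -β ^ 2 * hX

theorem charPoly_third {α β γ : ℝ} {X : Space} (hX : dot X X = 1) :
    γ ^ 2 - planeTrace α β γ X * γ + planeDet α β γ X = X 2 ^ 2 * ((γ - α) * (γ - β)) := by
  simp only [dot, planeTrace, planeDet] at *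
  linear_combination -γ ^ 2 * hX

theorem IsEig.root {α β γ μ : ℝ} {X W : Space} (hαβ : α ≠ β) (hβγ : β ≠ γ) (hαγ : α ≠ γ)
    (hX : dot X X = 1) (h : IsEig α β γ X μ W) :
    μ ^ 2 - planeTrace α β γ X * μ + planeDet α β γ X = 0 := by
  obtain ⟨hW, hXW, ρ, h0, h1, h2⟩ := (isEig_iff hX).1 h
  -- If ρ = 0, then `W` is an eigenvector of the full diagonal operator, hence lies on a coordinate
  -- axis, and the corresponding coordinate of `X` vanishes. Otherwise the equations express W
  -- through X, and X · W = 0 with denominators cleared is ρ times the characteristic equation.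
  by_cases hρ : ρ = 0
  · subst hρ
    simp only [zero_mul, mul_eq_zero, sub_eq_zero] at h0 h1 h2
    by_cases hα : α = μ
    · subst hα
      have w1 : W 1 = 0 := h1.resolve_left (fun h => hαβ h.symm)
      have w2 : W 2 = 0 := h2.resolve_left (fun h => hαγ h.symm)
      have w0 : W 0 ≠ 0 := fun w0 => hW (space_ext w0 w1 w2)
      have : X 0 = 0 := by simpa [dot, w1, w2, w0] using hXW
      rw [charPoly_first hX, this]; ring
    have w0 := h0.resolve_left hα
    by_cases hβ : β = μ
    · subst hβ
      have w2 : W 2 = 0 := h2.resolve_left (fun h => hβγ h.symm)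
      have w1 : W 1 ≠ 0 := fun w1 => hW (space_ext w0 w1 w2)
      have : X 1 = 0 := by simpa [dot, w0, w2, w1] using hXW
      rw [charPoly_second hX, this]; ring
    have w1 := h1.resolve_left hβ
    have w2 : W 2 ≠ 0 := fun w2 => hW (space_ext w0 w1 w2)
    have hγ := h2.resolve_right w2
    subst hγ
    have : X 2 = 0 := by simpa [dot, w0, w1, w2] using hXW
    rw [charPoly_third hX, this]; ring
  · have : ρ * (μ ^ 2 - planeTrace α β γ X * μ + planeDet α β γ X) = 0 := by
      simp only [dot, planeTrace, planeDet] at *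
      linear_combination (-(X 0) * (β - μ) * (γ - μ)) * h0 + (-(X 1) * (α - μ) * (γ - μ)) * h1
        + (-(X 2) * (α - μ) * (β - μ)) * h2 + (α - μ) * (β - μ) * (γ - μ) * hXW
        - ρ * μ ^ 2 * hX
    exact (mul_eq_zero.1 this).resolve_left hρ

theorem cross_ne_zero {X W : Space} (hX : dot X X = 1) (hW : W ≠ 0) (h : dot X W = 0) :
    dot (cross X W) (cross X W) = dot W W ∧ cross X W ≠ 0 := by
  have h1 : dot (cross X W) (cross X W) = dot W W := by
    simp only [dot, cross, Matrix.cons_val_zero, Matrix.cons_val_one, Matrix.cons_val] at *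
    linear_combination (W 0 ^ 2 + W 1 ^ 2 + W 2 ^ 2) * hX
      - (X 0 * W 0 + X 1 * W 1 + X 2 * W 2) * h
  refine ⟨h1, fun h2 => ?_⟩
  rw [h2] at h1
  have := dot_self_pos hW
  simp [dot] at h1 this
  linarith

theorem dot_cross_left (X W : Space) : dot X (cross X W) = 0 := by
  simp [dot, cross]; ring

theorem dot_cross_right (X W : Space) : dot W (cross X W) = 0 := by
  simp [dot, cross]; ring

theorem dot_comm (U V : Space) : dot U V = dot V U := by simp only [dot]; ring

/-- A self-adjoint operator on a plane preserves the orthogonal complement of an eigenvector, and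
the trace gives the second eigenvalue. -/
theorem IsEig.cross {α β γ μ : ℝ} {X W : Space} (hX : dot X X = 1) (h : IsEig α β γ X μ W) :
    IsEig α β γ X (planeTrace α β γ X - μ) (cross X W) := by
  obtain ⟨hW, hXW, H⟩ := h
  obtain ⟨hc, hc0⟩ := cross_ne_zero hX hW hXW
  refine ⟨hc0, dot_cross_left X W, fun V hV => ?_⟩
  have e1 := H (Minkowski.cross X W) (dot_cross_left X W)
  rw [dot_cross_right, mul_zero] at e1
  have e2 := H W hXW
  have hn := (dot_self_pos hW).ne'
  -- The trace in the orthogonal basis `W`, X × W, whose vectors have equal length. The squares of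
  -- the coordinates of X × W come from the completeness of the frame formed with `X`.
  have tr : diagForm α β γ W W + diagForm α β γ (Minkowski.cross X W) (Minkowski.cross X W)
      = planeTrace α β γ X * dot W W := by
    have k0 : (Minkowski.cross X W) 0 ^ 2 = dot W W * (1 - X 0 ^ 2) - W 0 ^ 2 := by
      simp only [dot, Minkowski.cross, Matrix.cons_val_zero, Matrix.cons_val_one, Matrix.cons_val]
        at *
      linear_combination (W 1 ^ 2 + W 2 ^ 2) * hX - (X 1 * W 1 + X 2 * W 2 - X 0 * W 0) * hXW
    have k1 : (Minkowski.cross X W) 1 ^ 2 = dot W W * (1 - X 1 ^ 2) - W 1 ^ 2 := by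
      simp only [dot, Minkowski.cross, Matrix.cons_val_zero, Matrix.cons_val_one, Matrix.cons_val]
        at *
      linear_combination (W 0 ^ 2 + W 2 ^ 2) * hX - (X 0 * W 0 + X 2 * W 2 - X 1 * W 1) * hXW
    have k2 : (Minkowski.cross X W) 2 ^ 2 = dot W W * (1 - X 2 ^ 2) - W 2 ^ 2 := by
      simp only [dot, Minkowski.cross, Matrix.cons_val_zero, Matrix.cons_val_one, Matrix.cons_val]
        at *
      linear_combination (W 0 ^ 2 + W 1 ^ 2) * hX - (X 0 * W 0 + X 1 * W 1 - X 2 * W 2) * hXW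
    simp only [diagForm, planeTrace]
    have hX' : X 0 * X 0 + X 1 * X 1 + X 2 * X 2 = 1 := hX
    linear_combination α * k0 + β * k1 + γ * k2 - dot W W * (α + β + γ) * hX'
  have dec : ∀ i, dot W W * V i = dot V W * W i
      + dot V (Minkowski.cross X W) * (Minkowski.cross X W) i := by
    intro i
    rw [← hc]
    have t0 : X 0 * dot V W - W 0 * dot X V = V 1 * (Minkowski.cross X W) 2
        - V 2 * (Minkowski.cross X W) 1 := by
      simp [dot, Minkowski.cross]; ring
    have t1 : X 1 * dot V W - W 1 * dot X V = V 2 * (Minkowski.cross X W) 0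
        - V 0 * (Minkowski.cross X W) 2 := by
      simp [dot, Minkowski.cross]; ring
    have t2 : X 2 * dot V W - W 2 * dot X V = V 0 * (Minkowski.cross X W) 1
        - V 1 * (Minkowski.cross X W) 0 := by
      simp [dot, Minkowski.cross]; ring
    rw [hV] at t0 t1 t2
    have u0 : (Minkowski.cross X W) 1 * X 2 - (Minkowski.cross X W) 2 * X 1
        = W 0 * dot X X - X 0 * dot X W := by
      simp [dot, Minkowski.cross]; ring
    have u1 : (Minkowski.cross X W) 2 * X 0 - (Minkowski.cross X W) 0 * X 2
        = W 1 * dot X X - X 1 * dot X W := by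
      simp [dot, Minkowski.cross]; ring
    have u2 : (Minkowski.cross X W) 0 * X 1 - (Minkowski.cross X W) 1 * X 0
        = W 2 * dot X X - X 2 * dot X W := by
      simp [dot, Minkowski.cross]; ring
    rw [hX, hXW] at u0 u1 u2
    generalize Minkowski.cross X W = C at *
    generalize hd : dot V W = d at *
    fin_cases i <;> simp only [Fin.mk_zero, Fin.mk_one, Fin.reduceFinMk, Fin.isValue, dot]
    · linear_combination d * u0 - C 1 * t2 + C 2 * t1
    · linear_combination d * u1 - C 2 * t0 + C 0 * t2
    · linear_combination d * u2 - C 0 * t1 + C 1 * t0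
  have key : dot W W * diagForm α β γ (Minkowski.cross X W) V =
      dot W W * ((planeTrace α β γ X - μ) * dot (Minkowski.cross X W) V) := by
    have : dot W W * diagForm α β γ (Minkowski.cross X W) V =
        dot V W * diagForm α β γ W (Minkowski.cross X W)
        + dot V (Minkowski.cross X W)
          * diagForm α β γ (Minkowski.cross X W) (Minkowski.cross X W) := by
      simp only [diagForm]
      linear_combination α * (Minkowski.cross X W) 0 * dec 0 + β * (Minkowski.cross X W) 1 * dec 1
        + γ * (Minkowski.cross X W) 2 * dec 2
    rw [this, e1, dot_comm (Minkowski.cross X W) V]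
    linear_combination dot V (Minkowski.cross X W) * (tr - e2)
  exact mul_left_cancel₀ hn key

/-! ### The two eigenvalues -/

section Roots

variable {α β γ : ℝ} {X : Space}

/-- The characteristic polynomial is nonpositive at β, so it has real roots. -/
theorem planeDisc_nonneg (hαβ : β < α) (hβγ : γ < β) (hX : dot X X = 1) :
    0 ≤ planeDisc α β γ X := by
  have h := charPoly_second (α := α) (β := β) (γ := γ) hX
  have : X 1 ^ 2 * ((β - α) * (β - γ)) ≤ 0 := by
    have : 0 ≤ (α - β) * (β - γ) := mul_nonneg (by linarith) (by linarith)
    nlinarith [sq_nonneg (X 1)]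
  simp only [planeDisc]
  nlinarith [sq_nonneg (2 * β - planeTrace α β γ X)]

theorem lamMax_add_lamMin : lamMax α β γ X + lamMin α β γ X = planeTrace α β γ X := by
  simp only [lamMax, lamMin]; ring

theorem lamMax_sub_lamMin : lamMax α β γ X - lamMin α β γ X = √(planeDisc α β γ X) := by
  simp only [lamMax, lamMin]; ring

theorem lamMin_le_lamMax : lamMin α β γ X ≤ lamMax α β γ X := by
  have := Real.sqrt_nonneg (planeDisc α β γ X)
  linarith [lamMax_sub_lamMin (α := α) (β := β) (γ := γ) (X := X)]

theorem lamMax_mul_lamMin (hαβ : β < α) (hβγ : γ < β) (hX : dot X X = 1) :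
    lamMax α β γ X * lamMin α β γ X = planeDet α β γ X := by
  have h := Real.sq_sqrt (planeDisc_nonneg hαβ hβγ hX)
  have h' : planeDisc α β γ X = planeTrace α β γ X ^ 2 - 4 * planeDet α β γ X := rfl
  simp only [lamMax, lamMin]
  linear_combination -h / 4 - h' / 4

theorem charPoly_eq (hαβ : β < α) (hβγ : γ < β) (hX : dot X X = 1) (t : ℝ) :
    t ^ 2 - planeTrace α β γ X * t + planeDet α β γ X
      = (t - lamMax α β γ X) * (t - lamMin α β γ X) := by
  rw [← lamMax_add_lamMin, ← lamMax_mul_lamMin hαβ hβγ hX]; ring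

theorem first_sq (hαβ : β < α) (hβγ : γ < β) (hX : dot X X = 1) :
    X 0 ^ 2 * ((α - β) * (α - γ)) = (α - lamMax α β γ X) * (α - lamMin α β γ X) := by
  rw [← charPoly_first hX, charPoly_eq hαβ hβγ hX]

theorem second_sq (hαβ : β < α) (hβγ : γ < β) (hX : dot X X = 1) :
    X 1 ^ 2 * ((α - β) * (β - γ)) = (lamMax α β γ X - β) * (β - lamMin α β γ X) := by
  have := charPoly_second (α := α) (β := β) (γ := γ) hX
  rw [charPoly_eq hαβ hβγ hX] at this
  linear_combination this

theorem third_sq (hαβ : β < α) (hβγ : γ < β) (hX : dot X X = 1) :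
    X 2 ^ 2 * ((α - γ) * (β - γ)) = (lamMax α β γ X - γ) * (lamMin α β γ X - γ) := by
  have := charPoly_third (α := α) (β := β) (γ := γ) hX
  rw [charPoly_eq hαβ hβγ hX] at this
  linear_combination -this

/-- Cauchy interlacing: the squares of the coordinates fix the signs of the characteristic
polynomial at α, β and γ. -/
theorem lam_bounds (hαβ : β < α) (hβγ : γ < β) (hX : dot X X = 1) :
    γ ≤ lamMin α β γ X ∧ lamMin α β γ X ≤ β ∧ β ≤ lamMax α β γ X ∧ lamMax α β γ X ≤ α := by
  have h1 := first_sq hαβ hβγ hX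
  have h2 := second_sq hαβ hβγ hX
  have h3 := third_sq hαβ hβγ hX
  have h := lamMin_le_lamMax (α := α) (β := β) (γ := γ) (X := X)
  set u := lamMax α β γ X
  set v := lamMin α β γ X
  have p1 : 0 ≤ (α - u) * (α - v) := by
    rw [← h1]; exact mul_nonneg (sq_nonneg _) (mul_nonneg (by linarith) (by linarith))
  have p2 : 0 ≤ (u - β) * (β - v) := by
    rw [← h2]; exact mul_nonneg (sq_nonneg _) (mul_nonneg (by linarith) (by linarith))
  have p3 : 0 ≤ (u - γ) * (v - γ) := by
    rw [← h3]; exact mul_nonneg (sq_nonneg _) (mul_nonneg (by linarith) (by linarith))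
  have a1 : v ≤ β := by
    by_contra hv
    push Not at hv
    nlinarith
  have a2 : β ≤ u := by
    by_contra hv
    push Not at hv
    nlinarith
  refine ⟨?_, a1, a2, ?_⟩
  · by_contra hv
    push Not at hv
    nlinarith
  · by_contra hv
    push Not at hv
    nlinarith

theorem lam_unique {u v : ℝ} (huv : v ≤ u)
    (hs : planeTrace α β γ X = u + v) (hm : planeDet α β γ X = u * v) :
    lamMax α β γ X = u ∧ lamMin α β γ X = v := by
  have : √(planeDisc α β γ X) = u - v := by
    rw [planeDisc, hs, hm, show (u + v) ^ 2 - 4 * (u * v) = (u - v) ^ 2 by ring,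
      Real.sqrt_sq (by linarith)]
  simp only [lamMax, lamMin, this, hs]
  constructor <;> ring

theorem IsEig.eq_or {μ : ℝ} {W : Space} (hαβ : β < α) (hβγ : γ < β) (hX : dot X X = 1)
    (h : IsEig α β γ X μ W) : μ = lamMax α β γ X ∨ μ = lamMin α β γ X := by
  have := h.root hαβ.ne' hβγ.ne' (hβγ.trans hαβ).ne' hX
  rw [charPoly_eq hαβ hβγ hX, mul_eq_zero, sub_eq_zero, sub_eq_zero] at this
  exact this

theorem continuous_lamMax : Continuous (lamMax α β γ) := by
  unfold lamMax planeDisc planeTrace planeDet; fun_prop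

theorem continuous_lamMin : Continuous (lamMin α β γ) := by
  unfold lamMin planeDisc planeTrace planeDet; fun_prop

end Roots

/-! ### Integral curves on the unit sphere -/

/-- The squares of the coordinates of `X` are those of the point of the unit sphere with
confocal coordinates `e` and `k * r`, for the diagonal form with coefficients `1, r, 0`. -/
def HasConfocalCoords (r k : ℝ) (X : Space) (e : ℝ) : Prop :=
  X 0 ^ 2 * (1 - r) = (1 - e) * (1 - k * r) ∧ X 1 ^ 2 * (1 - r) = (e - r) * (1 - k) ∧
    X 2 ^ 2 = e * k

/-- The curve on the unit sphere along which the confocal coordinate `k * r` is constant. -/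
def confocalCurve (r k σ θ : ℝ) : Space :=
  ![√(1 - k * r) * Real.cos θ, √(1 - k) * Real.sin θ,
    σ * √k * √(r + (1 - r) * Real.sin θ ^ 2)]

/-- The velocity of `confocalCurve`. -/
def confocalVelocity (r k σ θ : ℝ) : Space :=
  ![-(√(1 - k * r) * Real.sin θ), √(1 - k) * Real.cos θ,
    σ * √k * ((1 - r) * Real.sin θ * Real.cos θ / √(r + (1 - r) * Real.sin θ ^ 2))]

section Curve

variable {r k σ : ℝ}

theorem confocal_pos (hr0 : 0 < r) (hr1 : r < 1) (θ : ℝ) :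
    0 < r + (1 - r) * Real.sin θ ^ 2 := by
  have : 0 ≤ (1 - r) * Real.sin θ ^ 2 := mul_nonneg (by linarith) (sq_nonneg _)
  linarith

/-- The angle is used instead of the moving eigenvalue r + (1-r) sin² θ because it passes smoothly
through the coordinate planes; the radicand stays positive as r > 0. -/
theorem contDiff_confocalCurve (hr0 : 0 < r) (hr1 : r < 1) :
    ContDiff ℝ ∞ (confocalCurve r k σ) := by
  rw [contDiff_pi]
  intro i
  fin_cases i
  · exact contDiff_const.mul Real.contDiff_cos
  · exact contDiff_const.mul Real.contDiff_sin
  · refine contDiff_const.mul (ContDiff.sqrt ?_ fun θ => (confocal_pos hr0 hr1 θ).ne')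
    exact contDiff_const.add (contDiff_const.mul (Real.contDiff_sin.pow 2))

theorem hasDerivAt_confocalCurve (hr0 : 0 < r) (hr1 : r < 1) (θ : ℝ) :
    HasDerivAt (confocalCurve r k σ) (confocalVelocity r k σ θ) θ := by
  rw [hasDerivAt_pi]
  intro i
  fin_cases i
  · change HasDerivAt _ (-(√(1 - k * r) * Real.sin θ)) θ
    rw [← mul_neg]
    exact (Real.hasDerivAt_cos θ).const_mul (√(1 - k * r))
  · exact (Real.hasDerivAt_sin θ).const_mul (√(1 - k))
  · have h := ((((Real.hasDerivAt_sin θ).pow 2).const_mul (1 - r)).const_add r).sqrt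
      (confocal_pos hr0 hr1 θ).ne'
    refine (h.const_mul (σ * √k)).congr_deriv ?_
    change _ = σ * √k * ((1 - r) * Real.sin θ * Real.cos θ / √(r + (1 - r) * Real.sin θ ^ 2))
    have hn := (Real.sqrt_pos.2 (confocal_pos hr0 hr1 θ)).ne'
    simp only [Pi.pow_apply]
    field_simp
    norm_num
    ring

theorem hasConfocalCoords_confocalCurve (hr0 : 0 < r) (hr1 : r < 1) (hk0 : 0 ≤ k) (hk1 : k ≤ 1)
    (hσ : σ ^ 2 = 1) (θ : ℝ) :
    HasConfocalCoords r k (confocalCurve r k σ θ) (r + (1 - r) * Real.sin θ ^ 2) := by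
  have e1 : √(1 - k * r) ^ 2 = 1 - k * r := Real.sq_sqrt (by nlinarith)
  have e2 : √(1 - k) ^ 2 = 1 - k := Real.sq_sqrt (by linarith)
  have e3 : √k ^ 2 = k := Real.sq_sqrt hk0
  have e4 := Real.sq_sqrt (confocal_pos hr0 hr1 θ).le
  have e5 := Real.sin_sq_add_cos_sq θ
  refine ⟨?_, ?_, ?_⟩ <;> simp only [confocalCurve, Matrix.cons_val_zero, Matrix.cons_val_one,
    Matrix.cons_val, mul_pow, e1, e2, e3, e4, hσ]
  · linear_combination (1 - k * r) * (1 - r) * e5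
  · ring
  · ring

theorem confocalVelocity_eig (hr0 : 0 < r) (hr1 : r < 1) (θ : ℝ) :
    ∃ ρ, (1 - (r + (1 - r) * Real.sin θ ^ 2)) * confocalVelocity r k σ θ 0
        = ρ * confocalCurve r k σ θ 0 ∧
      (r - (r + (1 - r) * Real.sin θ ^ 2)) * confocalVelocity r k σ θ 1
        = ρ * confocalCurve r k σ θ 1 ∧
      -(r + (1 - r) * Real.sin θ ^ 2) * confocalVelocity r k σ θ 2
        = ρ * confocalCurve r k σ θ 2 := by
  have e5 := Real.sin_sq_add_cos_sq θ
  have h := confocal_pos hr0 hr1 θ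
  refine ⟨-((1 - r) * Real.sin θ * Real.cos θ), ?_, ?_, ?_⟩ <;>
    simp only [confocalCurve, confocalVelocity, Matrix.cons_val_zero, Matrix.cons_val_one,
      Matrix.cons_val]
  · linear_combination (-(√(1 - k * r)) * Real.sin θ * (1 - r)) * (-e5)
  · ring
  · have e4 := Real.sq_sqrt h.le
    have hn := (Real.sqrt_pos.2 h).ne'
    generalize √(r + (1 - r) * Real.sin θ ^ 2) = w at *
    field_simp
    linear_combination (-σ * √k * (1 - r) * Real.sin θ * Real.cos θ) * (-e4)

theorem dot_confocalVelocity (hr0 : 0 < r) (hr1 : r < 1) (hk0 : 0 ≤ k) (hk1 : k ≤ 1)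
    (hσ : σ ^ 2 = 1) (θ : ℝ) : dot (confocalCurve r k σ θ) (confocalVelocity r k σ θ) = 0 := by
  have e1 : √(1 - k * r) ^ 2 = 1 - k * r := Real.sq_sqrt (by nlinarith)
  have e2 : √(1 - k) ^ 2 = 1 - k := Real.sq_sqrt (by linarith)
  have e3 : √k ^ 2 = k := Real.sq_sqrt hk0
  have hn := (Real.sqrt_pos.2 (confocal_pos hr0 hr1 θ)).ne'
  simp only [dot, confocalCurve, confocalVelocity, Matrix.cons_val_zero, Matrix.cons_val_one,
    Matrix.cons_val]
  generalize √(r + (1 - r) * Real.sin θ ^ 2) = w at *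
  field_simp
  rw [e1, e2, e3, hσ]
  ring

/-- For k = 1 the velocity vanishes where sin θ = 0. These are the umbilic points, where both
eigenvalues equal r. -/
theorem confocalVelocity_ne_zero (hr0 : 0 < r) (hr1 : r < 1) (hk1 : k ≤ 1)
    {θ : ℝ} (h : k ≠ 1 ∨ Real.sin θ ≠ 0) : confocalVelocity r k σ θ ≠ 0 := by
  intro H
  have h0 : √(1 - k * r) * Real.sin θ = 0 := by simpa [confocalVelocity] using congrFun H 0
  have h1 : √(1 - k) * Real.cos θ = 0 := by simpa [confocalVelocity] using congrFun H 1
  have hp : √(1 - k * r) ≠ 0 := (Real.sqrt_pos.2 (by nlinarith)).ne'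
  have hs := (mul_eq_zero.1 h0).resolve_left hp
  have hk := h.resolve_right (not_not.2 hs)
  have hq : √(1 - k) ≠ 0 := (Real.sqrt_pos.2 (by
    rw [sub_pos]; exact lt_of_le_of_ne hk1 hk)).ne'
  have hc := (mul_eq_zero.1 h1).resolve_left hq
  have := Real.sin_sq_add_cos_sq θ
  rw [hs, hc] at this
  norm_num at this

theorem exists_angle {a b : ℝ} (h : a ^ 2 + b ^ 2 = 1) :
    ∃ θ ∈ Set.Ioo (-4 : ℝ) 4, Real.cos θ = a ∧ Real.sin θ = b := by
  have hn : ‖(⟨a, b⟩ : ℂ)‖ = 1 := by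
    rw [Complex.norm_def, Complex.normSq_mk, Real.sqrt_eq_one]; linarith
  have h0 : (⟨a, b⟩ : ℂ) ≠ 0 := by
    intro h; rw [h] at hn; simp at hn
  refine ⟨Complex.arg ⟨a, b⟩, ⟨?_, ?_⟩, ?_, ?_⟩
  · linarith [Complex.neg_pi_lt_arg ⟨a, b⟩, Real.pi_le_four]
  · have := Complex.arg_le_pi ⟨a, b⟩
    linarith [Real.pi_lt_d2]
  · rw [Complex.cos_arg h0, hn]; simp
  · rw [Complex.sin_arg, hn]; simp

/-- For k ≠ 1 the level curve is closed, and (-4, 4) contains a full turn because π < 4. For k = 1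
it is an open arc between the umbilic points at θ = 0 and θ = π. -/
theorem mem_confocalCurve (hr0 : 0 < r) (hr1 : r < 1) (hk0 : 0 ≤ k) (hk1 : k ≤ 1)
    {X : Space} {e : ℝ} (he0 : r ≤ e) (hne : e ≠ k * r)
    (hX : HasConfocalCoords r k X e) (hσ : 0 ≤ σ * X 2) (hσ2 : σ ^ 2 = 1) :
    X ∈ confocalCurve r k σ '' if k = 1 then Set.Ioo 0 Real.pi else Set.Ioo (-4) 4 := by
  obtain ⟨h0, h1, h2⟩ := hX
  have hr : 0 < 1 - r := by linarith
  have hkr : 0 < 1 - k * r := by nlinarith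
  have hp : √(1 - k * r) ≠ 0 := (Real.sqrt_pos.2 hkr).ne'
  have e1 : √(1 - k * r) ^ 2 = 1 - k * r := Real.sq_sqrt hkr.le
  have e2 : √(1 - k) ^ 2 = 1 - k := Real.sq_sqrt (by linarith)
  have third : ∀ θ, (1 - r) * Real.sin θ ^ 2 = e - r →
      σ * √k * √(r + (1 - r) * Real.sin θ ^ 2) = X 2 := by
    intro θ hθ
    have : √k * √e = |X 2| := by
      rw [← Real.sqrt_mul hk0, mul_comm, ← h2, Real.sqrt_sq_eq_abs]
    rw [hθ, add_sub_cancel, mul_assoc, this]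
    rcases mul_self_eq_one_iff.1 ((sq σ).symm.trans hσ2) with rfl | rfl
    · rw [one_mul, abs_of_nonneg (by linarith)]
    · rw [abs_of_nonpos (by linarith)]; ring
  have c0 : (X 0 / √(1 - k * r)) ^ 2 = (1 - e) / (1 - r) := by
    rw [div_pow, e1, div_eq_div_iff hkr.ne' hr.ne']; exact h0
  split_ifs with hk
  · subst hk
    have her : r < e := lt_of_le_of_ne he0 (by simpa using hne.symm)
    have hlt : (X 0 / √(1 - 1 * r)) ^ 2 < 1 := by
      rw [c0, div_lt_one hr]; linarith
    rw [sq_lt_one_iff_abs_lt_one, abs_lt] at hlt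
    have hc := Real.cos_arccos hlt.1.le hlt.2.le
    refine ⟨Real.arccos (X 0 / √(1 - 1 * r)), ⟨Real.arccos_pos.2 hlt.2, ?_⟩, ?_⟩
    · refine lt_of_le_of_ne (Real.arccos_le_pi _) fun h => ?_
      rw [Real.arccos_eq_pi] at h
      linarith
    · have hX1 : X 1 = 0 := by
        rw [sub_self, mul_zero, mul_eq_zero] at h1
        simpa using h1.resolve_right hr.ne'
      refine space_ext ?_ ?_ (third _ ?_)
      · simp only [confocalCurve, Matrix.cons_val_zero]
        rw [hc]; field_simp
      · simp [confocalCurve, hX1]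
      · rw [Real.sin_sq, hc, c0]; field_simp; ring
  · have hk' : 0 < 1 - k := by rw [sub_pos]; exact lt_of_le_of_ne hk1 hk
    have hq : √(1 - k) ≠ 0 := (Real.sqrt_pos.2 hk').ne'
    have c1 : (X 1 / √(1 - k)) ^ 2 = (e - r) / (1 - r) := by
      rw [div_pow, e2, div_eq_div_iff hk'.ne' hr.ne']; exact h1
    obtain ⟨θ, hθ, hc, hs⟩ := exists_angle (a := X 0 / √(1 - k * r)) (b := X 1 / √(1 - k)) (by
      rw [c0, c1]; field_simp; ring)
    refine ⟨θ, hθ, space_ext ?_ ?_ (third _ ?_)⟩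
    · simp only [confocalCurve, Matrix.cons_val_zero]
      rw [hc]; field_simp
    · simp only [confocalCurve, Matrix.cons_val_one, Matrix.cons_val_zero]
      rw [hs]; field_simp
    · rw [hs, c1]; field_simp

theorem exists_confocalCurve (hr0 : 0 < r) (hr1 : r < 1) (hk0 : 0 ≤ k) (hk1 : k ≤ 1)
    {X X' : Space} {e e' : ℝ} (he0 : r ≤ e) (hne : e ≠ k * r)
    (hX : HasConfocalCoords r k X e) (he0' : r ≤ e') (hne' : e' ≠ k * r)
    (hX' : HasConfocalCoords r k X' e') (hsign : SignType.sign (X 2) = SignType.sign (X' 2)) :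
    ∃ (Γ W : ℝ → Space) (s t : ℝ), ContDiff ℝ ∞ Γ ∧ (∀ τ, HasDerivAt Γ (W τ) τ) ∧
      X ∈ Γ '' Set.Ioo s t ∧ X' ∈ Γ '' Set.Ioo s t ∧ ∀ τ ∈ Set.Ioo s t, W τ ≠ 0 ∧
        dot (Γ τ) (W τ) = 0 ∧ ∃ u ρ, r ≤ u ∧ u ≤ 1 ∧ u ≠ k * r ∧ HasConfocalCoords r k (Γ τ) u ∧
          (1 - u) * W τ 0 = ρ * Γ τ 0 ∧ (r - u) * W τ 1 = ρ * Γ τ 1 ∧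
          -u * W τ 2 = ρ * Γ τ 2 := by
  -- σ is the common sign of the third coordinates. If they vanish then k = 0, and either choice
  -- gives the same curve.
  obtain ⟨σ, hσ2, hσ, hσ'⟩ : ∃ σ : ℝ, σ ^ 2 = 1 ∧ 0 ≤ σ * X 2 ∧ 0 ≤ σ * X' 2 := by
    rcases lt_trichotomy (X 2) 0 with h | h | h
    · rw [sign_neg h, eq_comm, sign_eq_neg_one_iff] at hsign
      exact ⟨-1, by norm_num, by linarith, by linarith⟩
    · rw [h, sign_zero, eq_comm, sign_eq_zero_iff] at hsign
      exact ⟨1, by norm_num, by linarith, by linarith⟩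
    · rw [sign_pos h, eq_comm, sign_eq_one_iff] at hsign
      exact ⟨1, by norm_num, by linarith, by linarith⟩
  obtain ⟨s, t, hst, hI⟩ : ∃ s t : ℝ,
      (if k = 1 then Set.Ioo 0 Real.pi else Set.Ioo (-4) 4) = Set.Ioo s t ∧
        ∀ τ ∈ Set.Ioo s t, k ≠ 1 ∨ Real.sin τ ≠ 0 := by
    split_ifs with hk
    · exact ⟨_, _, rfl, fun τ hτ => Or.inr (Real.sin_pos_of_mem_Ioo hτ).ne'⟩
    · exact ⟨_, _, rfl, fun τ hτ => Or.inl hk⟩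
  refine ⟨confocalCurve r k σ, confocalVelocity r k σ, s, t, contDiff_confocalCurve hr0 hr1,
    hasDerivAt_confocalCurve hr0 hr1, hst ▸ mem_confocalCurve hr0 hr1 hk0 hk1 he0 hne hX hσ hσ2,
    hst ▸ mem_confocalCurve hr0 hr1 hk0 hk1 he0' hne' hX' hσ' hσ2, fun τ hτ => ?_⟩
  refine ⟨confocalVelocity_ne_zero hr0 hr1 hk1 (hI τ hτ),
    dot_confocalVelocity hr0 hr1 hk0 hk1 hσ2 τ, r + (1 - r) * Real.sin τ ^ 2, ?_⟩
  obtain ⟨ρ, hρ⟩ := confocalVelocity_eig (k := k) (σ := σ) hr0 hr1 τ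
  have hnn : 0 ≤ (1 - r) * Real.sin τ ^ 2 := mul_nonneg (by linarith) (sq_nonneg _)
  refine ⟨ρ, by linarith, ?_, ?_,
    hasConfocalCoords_confocalCurve hr0 hr1 hk0 hk1 hσ2 τ, hρ⟩
  · nlinarith [Real.sin_sq_le_one τ]
  · rcases hI τ hτ with h | h
    · have : k < 1 := lt_of_le_of_ne hk1 h
      nlinarith
    · have : 0 < (1 - r) * Real.sin τ ^ 2 := mul_pos (by linarith) (by positivity)
      nlinarith

end Curve

/-- The eigenvalue whose eigendirections form the `i`-th principal line field. -/
def eigval (i : Fin 2) : ℝ → ℝ → ℝ → Space → ℝ := if i = 0 then lamMin else lamMax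

/-- The eigenvalue that is constant along the `i`-th principal line field. -/
def coeigval (i : Fin 2) : ℝ → ℝ → ℝ → Space → ℝ := if i = 0 then lamMax else lamMin

/-- The coordinate whose sign is constant along the `i`-th principal line field. -/
def signCoord (i : Fin 2) : Fin 3 := if i = 0 then 0 else 2

/-- The points of the unit sphere at which the two eigenvalues differ. -/
def regularSphere (α β γ : ℝ) : Set Space :=
  {X | dot X X = 1 ∧ lamMin α β γ X ≠ lamMax α β γ X}

/-- A smooth integral curve on the unit sphere of the `i`-th field of eigendirections. -/
def IsEigCurve (α β γ : ℝ) (i : Fin 2) (Γ : ℝ → Space) (s t : ℝ) : Prop :=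
  ContDiffOn ℝ ∞ Γ (Set.Ioo s t) ∧ ∀ τ ∈ Set.Ioo s t, Γ τ ∈ regularSphere α β γ ∧
    IsEig α β γ (Γ τ) (eigval i α β γ (Γ τ)) (deriv Γ τ)

/-! ### Constants of motion along integral curves. -/

section Constancy

variable {α β γ : ℝ}

theorem hasDerivAt_planeTrace {Γ : ℝ → Space} {W : Space} {τ : ℝ} (h : HasDerivAt Γ W τ) :
    HasDerivAt (fun τ => planeTrace α β γ (Γ τ))
      (2 * ((β + γ) * Γ τ 0 * W 0 + (α + γ) * Γ τ 1 * W 1 + (α + β) * Γ τ 2 * W 2)) τ := by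
  rw [hasDerivAt_pi] at h
  refine (((((h 0).pow 2).const_mul (β + γ)).add (((h 1).pow 2).const_mul (α + γ))).add
    (((h 2).pow 2).const_mul (α + β))).congr_deriv ?_
  norm_num
  ring

theorem hasDerivAt_planeDet {Γ : ℝ → Space} {W : Space} {τ : ℝ} (h : HasDerivAt Γ W τ) :
    HasDerivAt (fun τ => planeDet α β γ (Γ τ))
      (2 * (β * γ * Γ τ 0 * W 0 + α * γ * Γ τ 1 * W 1 + α * β * Γ τ 2 * W 2)) τ := by
  rw [hasDerivAt_pi] at h
  refine (((((h 0).pow 2).const_mul (β * γ)).add (((h 1).pow 2).const_mul (α * γ))).add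
    (((h 2).pow 2).const_mul (α * β))).congr_deriv ?_
  norm_num
  ring

/-- Along an eigendirection with eigenvalue `μ` the characteristic polynomial changes by a multiple
of `X - c`, where `c` is the other eigenvalue. -/
theorem IsEig.deriv_charPoly {μ : ℝ} {X W : Space} (hX : dot X X = 1) (h : IsEig α β γ X μ W) :
    ∃ ρ, 2 * ((β + γ) * X 0 * W 0 + (α + γ) * X 1 * W 1 + (α + β) * X 2 * W 2) = -2 * ρ ∧
      2 * (β * γ * X 0 * W 0 + α * γ * X 1 * W 1 + α * β * X 2 * W 2)
        = -2 * ρ * (planeTrace α β γ X - μ) := by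
  obtain ⟨-, hXW, ρ, h0, h1, h2⟩ := (isEig_iff hX).1 h
  have ha : α * X 0 * W 0 + β * X 1 * W 1 + γ * X 2 * W 2 = ρ := by
    simp only [dot] at hX hXW
    linear_combination X 0 * h0 + X 1 * h1 + X 2 * h2 + ρ * hX + μ * hXW
  refine ⟨ρ, ?_, ?_⟩
  · simp only [dot] at hXW
    linear_combination (-2) * ha + 2 * (α + β + γ) * hXW
  · simp only [dot, planeTrace] at *
    linear_combination 2 * (α * β + β * γ + α * γ) * hXW - 2 * (α + β + γ) * ha
      + 2 * α * X 0 * h0 + 2 * β * X 1 * h1 + 2 * γ * X 2 * h2 + 2 * μ * ha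
      + 2 * ρ * (α + β + γ) * hX

/-- Let c be this eigenvalue and μ the other. The derivatives of μ + c and μc are -2ρ and -2ρc,
which gives (μ - c)c' = 0. Regularity makes the square root differentiable and allows the division
by μ - c. -/
theorem hasDerivAt_coeigval (i : Fin 2) {Γ : ℝ → Space} {W : Space}
    {τ : ℝ} (h : HasDerivAt Γ W τ) (hΓ : Γ τ ∈ regularSphere α β γ)
    (hW : IsEig α β γ (Γ τ) (eigval i α β γ (Γ τ)) W) :
    HasDerivAt (fun τ => coeigval i α β γ (Γ τ)) 0 τ := by
  obtain ⟨hX, hne⟩ := hΓ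
  obtain ⟨ρ, hs, hm⟩ := hW.deriv_charPoly hX
  have hT := hasDerivAt_planeTrace (α := α) (β := β) (γ := γ) h
  have hM := hasDerivAt_planeDet (α := α) (β := β) (γ := γ) h
  rw [hs] at hT
  rw [hm] at hM
  have hsum := lamMax_add_lamMin (α := α) (β := β) (γ := γ) (X := Γ τ)
  have hsub := lamMax_sub_lamMin (α := α) (β := β) (γ := γ) (X := Γ τ)
  have hpos : 0 < √(planeDisc α β γ (Γ τ)) := by
    rw [← hsub, sub_pos]; exact lt_of_le_of_ne lamMin_le_lamMax hne
  have hD : HasDerivAt (fun τ => planeDisc α β γ (Γ τ)) _ τ := (hT.pow 2).sub (hM.const_mul 4)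
  have hS := hD.sqrt (Real.sqrt_pos.1 hpos).ne'
  by_cases hi : i = 0
  · simp only [eigval, coeigval, hi, if_true] at *
    refine ((hT.add hS).div_const 2).congr_deriv ?_
    norm_num
    rw [← hsub] at hpos ⊢
    rw [← hsum]
    field_simp
    ring
  · simp only [eigval, coeigval, hi, if_false] at *
    refine ((hT.sub hS).div_const 2).congr_deriv ?_
    norm_num
    rw [← hsub] at hpos ⊢
    rw [← hsum]
    field_simp
    ring

/-- In the factored formula for the square of the coordinate, one factor cannot vanish by
interlacing. -/
theorem signCoord_eq_zero_iff (hαβ : β < α) (hβγ : γ < β) (i : Fin 2) {X : Space}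
    (hX : X ∈ regularSphere α β γ) :
    X (signCoord i) = 0 ↔ coeigval i α β γ X = if i = 0 then α else γ := by
  obtain ⟨hX, hne⟩ := hX
  have h1 := first_sq hαβ hβγ hX
  have h3 := third_sq hαβ hβγ hX
  obtain ⟨b1, b2, b3, b4⟩ := lam_bounds hαβ hβγ hX
  by_cases hi : i = 0
  · simp only [signCoord, coeigval, hi, if_true]
    have c : (α - β) * (α - γ) ≠ 0 := by
      apply mul_ne_zero <;> intro h <;> linarith
    have d : α - lamMin α β γ X ≠ 0 := by intro h; linarith
    constructor
    · intro h
      rw [h] at h1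
      have := (mul_eq_zero.1 (h1.symm.trans (by ring))).resolve_right d
      linarith
    · intro h
      rw [h, sub_self, zero_mul] at h1
      simpa using (mul_eq_zero.1 h1).resolve_right c
  · simp only [signCoord, coeigval, hi, if_false]
    have c : (α - γ) * (β - γ) ≠ 0 := by
      apply mul_ne_zero <;> intro h <;> linarith
    have d : lamMax α β γ X - γ ≠ 0 := by intro h; linarith
    constructor
    · intro h
      rw [h] at h3
      have := (mul_eq_zero.1 (h3.symm.trans (by ring))).resolve_left d
      linarith
    · intro h
      rw [h, sub_self, mul_zero] at h3
      simpa using (mul_eq_zero.1 h3).resolve_right c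

theorem sign_eq_of_ne_zero {f : ℝ → ℝ} {s t a b : ℝ} (hf : ContinuousOn f (Set.Ioo s t))
    (h : ∀ τ ∈ Set.Ioo s t, f τ ≠ 0) (ha : a ∈ Set.Ioo s t) (hb : b ∈ Set.Ioo s t) :
    SignType.sign (f a) = SignType.sign (f b) := by
  have key : ∀ {a b}, a ∈ Set.Ioo s t → b ∈ Set.Ioo s t → f a < 0 → f b < 0 := by
    intro a b ha hb hfa
    by_contra hfb
    push Not at hfb
    obtain ⟨c, hc, hc0⟩ := isPreconnected_Ioo.intermediate_value ha hb hf ⟨hfa.le, hfb⟩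
    exact h c hc hc0
  rcases lt_or_gt_of_ne (h a ha) with h1 | h1
  · rw [sign_neg h1, sign_neg (key ha hb h1)]
  · rcases lt_or_gt_of_ne (h b hb) with h2 | h2
    · linarith [key hb ha h2]
    · rw [sign_pos h1, sign_pos h2]

/-- The sign coordinate vanishes exactly when the conserved eigenvalue takes its extreme value, so
it vanishes along the whole curve or nowhere. In the latter case continuity fixes its sign. -/
theorem IsEigCurve.constant (hαβ : β < α) (hβγ : γ < β) {i : Fin 2} {Γ : ℝ → Space} {s t : ℝ}
    (h : IsEigCurve α β γ i Γ s t) {a b : ℝ} (ha : a ∈ Set.Ioo s t) (hb : b ∈ Set.Ioo s t) :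
    coeigval i α β γ (Γ a) = coeigval i α β γ (Γ b) ∧
      SignType.sign (Γ a (signCoord i)) = SignType.sign (Γ b (signCoord i)) := by
  have hd : ∀ τ ∈ Set.Ioo s t, HasDerivAt Γ (deriv Γ τ) τ := fun τ hτ =>
    ((h.1.contDiffAt (isOpen_Ioo.mem_nhds hτ)).differentiableAt (by simp)).hasDerivAt
  have hd' : ∀ τ ∈ Set.Ioo s t, HasDerivAt (fun τ => coeigval i α β γ (Γ τ)) 0 τ := fun τ hτ =>
    hasDerivAt_coeigval i (hd τ hτ) (h.2 τ hτ).1 (h.2 τ hτ).2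
  have hc : ∀ {a b}, a ∈ Set.Ioo s t → b ∈ Set.Ioo s t →
      coeigval i α β γ (Γ a) = coeigval i α β γ (Γ b) := fun ha hb =>
    isOpen_Ioo.is_const_of_deriv_eq_zero isPreconnected_Ioo
      (fun τ hτ => (hd' τ hτ).differentiableAt.differentiableWithinAt)
      (fun τ hτ => (hd' τ hτ).deriv) ha hb
  refine ⟨hc ha hb, ?_⟩
  by_cases h0 : Γ a (signCoord i) = 0
  · have := (signCoord_eq_zero_iff hαβ hβγ i (h.2 a ha).1).1 h0
    rw [hc ha hb] at this
    rw [h0, (signCoord_eq_zero_iff hαβ hβγ i (h.2 b hb).1).2 this]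
  · refine sign_eq_of_ne_zero (f := fun τ => Γ τ (signCoord i))
      (fun τ hτ => ((hasDerivAt_pi.1 (hd τ hτ)) (signCoord i)).continuousAt.continuousWithinAt)
      (fun τ hτ h1 => h0 ?_) ha hb
    rw [signCoord_eq_zero_iff hαβ hβγ i (h.2 a ha).1, hc ha hτ]
    exact (signCoord_eq_zero_iff hαβ hβγ i (h.2 τ hτ).1).1 h1

end Constancy

/-! ### Integral curves joining points with equal constants of motion. -/

section Existence

variable {α β γ : ℝ}

/-- The affine map t ↦ γ + Dt takes the coefficients 1, r, 0 to general ones and the eigenvalues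
with them. Negative D is needed when the order of the coefficients is reversed. -/
theorem HasConfocalCoords.plane {D r k u : ℝ} {X : Space} (hr : r ≠ 1)
    (h : HasConfocalCoords r k X u) : dot X X = 1 ∧
      planeTrace (γ + D) (γ + r * D) γ X = (γ + D * u) + (γ + D * (k * r)) ∧
      planeDet (γ + D) (γ + r * D) γ X = (γ + D * u) * (γ + D * (k * r)) := by
  obtain ⟨h0, h1, h2⟩ := h
  have hr' : 1 - r ≠ 0 := sub_ne_zero.2 hr.symm
  rw [← eq_div_iff hr'] at h0 h1
  refine ⟨?_, ?_, ?_⟩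
  · simp only [dot, ← sq]
    rw [h0, h1, h2]; field_simp; ring
  · simp only [planeTrace]
    rw [h0, h1, h2]; field_simp; ring
  · simp only [planeDet]
    rw [h0, h1, h2]; field_simp; ring

/-- The reflection that exchanges the first and the third coordinate. -/
def rev (X : Space) : Space := ![X 2, X 1, X 0]

theorem isEig_rev {μ : ℝ} {X W : Space} :
    IsEig γ β α (rev X) μ (rev W) → IsEig α β γ X μ W := by
  rintro ⟨h1, h2, h3⟩
  refine ⟨fun h => h1 ?_, ?_, fun V hV => ?_⟩
  · rw [h]; apply space_ext <;> simp [rev]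
  · simp only [dot, rev, Matrix.cons_val_zero, Matrix.cons_val_one, Matrix.cons_val] at *
    linarith
  · have := h3 (rev V) (by
      simp only [dot, rev, Matrix.cons_val_zero, Matrix.cons_val_one, Matrix.cons_val] at *
      linarith)
    simp only [dot, diagForm, rev, Matrix.cons_val_zero, Matrix.cons_val_one,
      Matrix.cons_val] at *
    linarith

theorem exists_isEigCurve_one (hαβ : β < α) (hβγ : γ < β) {X X' : Space}
    (hX : X ∈ regularSphere α β γ) (hX' : X' ∈ regularSphere α β γ)
    (hc : lamMin α β γ X = lamMin α β γ X')
    (hs : SignType.sign (X 2) = SignType.sign (X' 2)) :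
    ∃ Γ s t, IsEigCurve α β γ 1 Γ s t ∧ X ∈ Γ '' Set.Ioo s t ∧ X' ∈ Γ '' Set.Ioo s t := by
  have hD : 0 < α - γ := by linarith
  have hβ : 0 < β - γ := by linarith
  set c := lamMin α β γ X with hcdef
  -- The normalization t ↦ (t-γ)/(α-γ) sends α, β, γ to 1, r, 0 with r = (β-γ)/(α-γ). The constant
  -- eigenvalue c becomes kr with k = (c-γ)/(β-γ).
  have hkr : (c - γ) / (β - γ) * ((β - γ) / (α - γ)) = (c - γ) / (α - γ) := by field_simp
  have hco : ∀ {Y}, Y ∈ regularSphere α β γ → lamMin α β γ Y = c →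
      (β - γ) / (α - γ) ≤ (lamMax α β γ Y - γ) / (α - γ) ∧
      (lamMax α β γ Y - γ) / (α - γ) ≠ (c - γ) / (β - γ) * ((β - γ) / (α - γ)) ∧
      HasConfocalCoords ((β - γ) / (α - γ)) ((c - γ) / (β - γ)) Y
        ((lamMax α β γ Y - γ) / (α - γ)) := by
    intro Y hY hYc
    have h1 := first_sq hαβ hβγ hY.1
    have h2 := second_sq hαβ hβγ hY.1
    have h3 := third_sq hαβ hβγ hY.1
    rw [hYc] at h1 h2 h3
    refine ⟨?_, ?_, ?_, ?_, ?_⟩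
    · gcongr
      linarith [(lam_bounds hαβ hβγ hY.1).2.2.1]
    · rw [hkr, ← hYc]
      intro h
      rw [div_left_inj' hD.ne'] at h
      exact hY.2 (by linarith)
    · rw [hkr]; field_simp; linear_combination h1
    · field_simp; linear_combination h2
    · field_simp; linear_combination h3
  obtain ⟨b1, b2, b3, b4⟩ := lam_bounds hαβ hβγ hX.1
  obtain ⟨x1, x2, x3⟩ := hco hX rfl
  obtain ⟨y1, y2, y3⟩ := hco hX' hc.symm
  have hr1 : (β - γ) / (α - γ) < 1 := by rw [div_lt_one hD]; linarith
  obtain ⟨Γ, W, s, t, hΓ, hW, hmX, hmX', H⟩ := exists_confocalCurve (div_pos hβ hD) hr1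
    (div_nonneg (by linarith) hβ.le) (by rw [div_le_one hβ]; linarith) x1 x2 x3 y1 y2 y3 hs
  refine ⟨Γ, s, t, ⟨hΓ.contDiffOn, fun τ hτ => ?_⟩, hmX, hmX'⟩
  obtain ⟨hW0, hdot, u, ρ, u0, u1, une, hcc, e0, e1, e2⟩ := H τ hτ
  obtain ⟨p1, p2, p3⟩ := hcc.plane (γ := γ) (D := α - γ) hr1.ne
  rw [show γ + (α - γ) = α by ring, show γ + (β - γ) / (α - γ) * (α - γ) = β by
    field_simp; ring] at p2 p3
  rw [hkr] at p2 p3 une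
  rw [div_le_iff₀ hD] at u0
  have hc' : γ + (α - γ) * ((c - γ) / (α - γ)) = c := by field_simp; ring
  rw [hc'] at p2 p3
  obtain ⟨l1, l2⟩ := lam_unique (by linarith) p2 p3
  have hreg : Γ τ ∈ regularSphere α β γ := by
    refine ⟨p1, ?_⟩
    rw [l1, l2]
    intro h
    rw [ne_eq, eq_div_iff hD.ne'] at une
    exact une (by linarith)
  refine ⟨hreg, ?_⟩
  rw [(hW τ).deriv, eigval, if_neg (by decide), l1, isEig_iff p1]
  refine ⟨hW0, hdot, ρ * (α - γ), ?_, ?_, ?_⟩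
  · linear_combination (α - γ) * e0
  · rw [sub_mul, div_mul_eq_mul_div, sub_eq_iff_eq_add, div_eq_iff hD.ne'] at e1
    linear_combination e1
  · linear_combination (α - γ) * e2

/-- The normalization t ↦ (α-t)/(α-γ) reverses the order of the eigenvalues; together with the
exchange of the first and third coordinates by `rev` it allows the same model curves to be used. -/
theorem exists_isEigCurve_zero (hαβ : β < α) (hβγ : γ < β) {X X' : Space}
    (hX : X ∈ regularSphere α β γ) (hX' : X' ∈ regularSphere α β γ)
    (hc : lamMax α β γ X = lamMax α β γ X')
    (hs : SignType.sign (X 0) = SignType.sign (X' 0)) :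
    ∃ Γ s t, IsEigCurve α β γ 0 Γ s t ∧ X ∈ Γ '' Set.Ioo s t ∧ X' ∈ Γ '' Set.Ioo s t := by
  have hD : 0 < α - γ := by linarith
  have hβ : 0 < α - β := by linarith
  set c := lamMax α β γ X with hcdef
  have hkr : (α - c) / (α - β) * ((α - β) / (α - γ)) = (α - c) / (α - γ) := by field_simp
  have hco : ∀ {Y}, Y ∈ regularSphere α β γ → lamMax α β γ Y = c →
      (α - β) / (α - γ) ≤ (α - lamMin α β γ Y) / (α - γ) ∧
      (α - lamMin α β γ Y) / (α - γ) ≠ (α - c) / (α - β) * ((α - β) / (α - γ)) ∧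
      HasConfocalCoords ((α - β) / (α - γ)) ((α - c) / (α - β)) (rev Y)
        ((α - lamMin α β γ Y) / (α - γ)) := by
    intro Y hY hYc
    have h1 := first_sq hαβ hβγ hY.1
    have h2 := second_sq hαβ hβγ hY.1
    have h3 := third_sq hαβ hβγ hY.1
    rw [hYc] at h1 h2 h3
    refine ⟨?_, ?_, ?_, ?_, ?_⟩
    · gcongr
      linarith [(lam_bounds hαβ hβγ hY.1).2.1]
    · rw [hkr, ← hYc]
      intro h
      rw [div_left_inj' hD.ne'] at h
      exact hY.2 (by linarith)
    · rw [hkr]; simp only [rev, Matrix.cons_val_zero]; field_simp; linear_combination h3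
    · simp only [rev, Matrix.cons_val_zero, Matrix.cons_val_one]
      field_simp; linear_combination h2
    · simp only [rev, Matrix.cons_val]; field_simp; linear_combination h1
  obtain ⟨b1, b2, b3, b4⟩ := lam_bounds hαβ hβγ hX.1
  obtain ⟨x1, x2, x3⟩ := hco hX rfl
  obtain ⟨y1, y2, y3⟩ := hco hX' hc.symm
  have hr1 : (α - β) / (α - γ) < 1 := by rw [div_lt_one hD]; linarith
  obtain ⟨Γ, W, s, t, hΓ, hW, ⟨a, ha, haX⟩, ⟨b, hb, hbX⟩, H⟩ :=
    exists_confocalCurve (div_pos hβ hD) hr1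
      (div_nonneg (by linarith) hβ.le) (by rw [div_le_one hβ]; linarith) x1 x2 x3 y1 y2 y3 hs
  have hrev : ∀ Y, rev (rev Y) = Y := fun Y => by apply space_ext <;> simp [rev]
  refine ⟨fun τ => rev (Γ τ), s, t, ⟨ContDiff.contDiffOn ?_, fun τ hτ => ?_⟩,
    ⟨a, ha, by simp only [haX, hrev]⟩, ⟨b, hb, by simp only [hbX, hrev]⟩⟩
  · rw [contDiff_pi] at hΓ ⊢
    intro i
    fin_cases i
    exacts [hΓ 2, hΓ 1, hΓ 0]
  have hW' : HasDerivAt (fun τ => rev (Γ τ)) (rev (W τ)) τ := by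
    have := hW τ
    rw [hasDerivAt_pi] at this ⊢
    intro i
    fin_cases i
    exacts [this 2, this 1, this 0]
  obtain ⟨hW0, hdot, u, ρ, u0, u1, une, hcc, e0, e1, e2⟩ := H τ hτ
  obtain ⟨p1, p2, p3⟩ := hcc.plane (γ := α) (D := γ - α) hr1.ne
  rw [show α + (γ - α) = γ by ring, show α + (α - β) / (α - γ) * (γ - α) = β by
    field_simp; ring] at p2 p3
  rw [hkr] at p2 p3 une
  rw [div_le_iff₀ hD] at u0
  have hc' : α + (γ - α) * ((α - c) / (α - γ)) = c := by field_simp; ring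
  rw [hc'] at p2 p3
  have q1 : dot (rev (Γ τ)) (rev (Γ τ)) = 1 := by
    rw [← p1]; simp [dot, rev]; ring
  have q2 : planeTrace α β γ (rev (Γ τ)) = c + (α + (γ - α) * u) := by
    rw [add_comm c, ← p2]; simp [planeTrace, rev]; ring
  have q3 : planeDet α β γ (rev (Γ τ)) = c * (α + (γ - α) * u) := by
    rw [mul_comm c, ← p3]; simp [planeDet, rev]; ring
  obtain ⟨l1, l2⟩ := lam_unique (by linarith) q2 q3
  have hreg : rev (Γ τ) ∈ regularSphere α β γ := by
    refine ⟨q1, ?_⟩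
    rw [l1, l2]
    intro h
    rw [ne_eq, eq_div_iff hD.ne'] at une
    exact une (by linarith)
  refine ⟨hreg, ?_⟩
  rw [hW'.deriv, eigval, if_pos rfl, l2]
  apply isEig_rev
  rw [hrev, hrev, isEig_iff p1]
  refine ⟨hW0, hdot, ρ * (γ - α), ?_, ?_, ?_⟩
  · linear_combination (γ - α) * e0
  · rw [sub_mul, div_mul_eq_mul_div, sub_eq_iff_eq_add, div_eq_iff hD.ne'] at e1
    linear_combination -e1
  · linear_combination (γ - α) * e2

/-- Two points of the unit sphere lie on a common integral curve if and only if they have the same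
constant of motion and lie on the same side. -/
theorem exists_isEigCurve_iff (hαβ : β < α) (hβγ : γ < β) (i : Fin 2) {X X' : Space} :
    (∃ Γ s t, IsEigCurve α β γ i Γ s t ∧ X ∈ Γ '' Set.Ioo s t ∧ X' ∈ Γ '' Set.Ioo s t) ↔
      X ∈ regularSphere α β γ ∧ X' ∈ regularSphere α β γ ∧
        coeigval i α β γ X = coeigval i α β γ X' ∧
        SignType.sign (X (signCoord i)) = SignType.sign (X' (signCoord i)) := by
  constructor
  · rintro ⟨Γ, s, t, h, ⟨a, ha, rfl⟩, ⟨b, hb, rfl⟩⟩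
    exact ⟨(h.2 a ha).1, (h.2 b hb).1, h.constant hαβ hβγ ha hb⟩
  · rintro ⟨hX, hX', hc, hs⟩
    fin_cases i
    · exact exists_isEigCurve_zero hαβ hβγ hX hX' hc hs
    · exact exists_isEigCurve_one hαβ hβγ hX hX' hc hs

end Existence

/-! ### More on eigendirections -/

section Eig

variable {α β γ : ℝ}

/-- The velocity of an integral curve through the point serves as eigenvector. -/
theorem exists_isEig (hαβ : β < α) (hβγ : γ < β) (i : Fin 2) {X : Space}
    (hX : X ∈ regularSphere α β γ) : ∃ W, IsEig α β γ X (eigval i α β γ X) W := by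
  obtain ⟨Γ, s, t, h, ⟨a, ha, rfl⟩, -⟩ :=
    (exists_isEigCurve_iff hαβ hβγ i).2 ⟨hX, hX, rfl, rfl⟩
  exact ⟨_, (h.2 a ha).2⟩

/-- Interlacing forces both eigenvalues to be β. Then X₁ = 0 and X₀², X₂² are determined, and the
restricted form is β times the Euclidean one. -/
theorem diagForm_eq_of_umbilic (hαβ : β < α) (hβγ : γ < β) {X W V : Space} (hX : dot X X = 1)
    (h : lamMin α β γ X = lamMax α β γ X) (hW : dot X W = 0) (hV : dot X V = 0) :
    diagForm α β γ W V = β * dot W V := by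
  obtain ⟨b1, b2, b3, b4⟩ := lam_bounds hαβ hβγ hX
  have e1 : lamMin α β γ X = β := by linarith
  have e2 : lamMax α β γ X = β := by linarith
  have h1 := first_sq hαβ hβγ hX
  have h2 := second_sq hαβ hβγ hX
  have h3 := third_sq hαβ hβγ hX
  rw [e1, e2] at h1 h2 h3
  have x1 : X 1 = 0 := by
    have : (α - β) * (β - γ) ≠ 0 := by apply mul_ne_zero <;> intro h <;> linarith
    rw [sub_self, zero_mul] at h2
    simpa using (mul_eq_zero.1 h2).resolve_right this
  have k1 : X 0 ^ 2 * (α - γ) = α - β :=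
    mul_left_cancel₀ (sub_ne_zero.2 hαβ.ne') (by linear_combination h1)
  have k3 : X 2 ^ 2 * (α - γ) = β - γ :=
    mul_left_cancel₀ (sub_ne_zero.2 hβγ.ne') (by linear_combination h3)
  simp only [dot, diagForm, x1, zero_mul, add_zero] at *
  linear_combination (-W 0 * V 0) * k1 + W 2 * V 2 * k3 + (α - γ) * X 0 * V 0 * hW
    - (α - γ) * X 2 * W 2 * hV

/-- The Cayley-Hamilton identity on the plane orthogonal to `X`. -/
theorem plane_cayley_hamilton {X Y V : Space} (hX : dot X X = 1) (hY : dot X Y = 0)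
    (hV : dot X V = 0) :
    α ^ 2 * Y 0 * V 0 + β ^ 2 * Y 1 * V 1 + γ ^ 2 * Y 2 * V 2
      - diagForm α β γ X Y * diagForm α β γ X V
      - planeTrace α β γ X * diagForm α β γ Y V + planeDet α β γ X * dot Y V = 0 := by
  have k0 : (X 1 * Y 2 - X 2 * Y 1) * (X 1 * V 2 - X 2 * V 1)
      = (1 - X 0 ^ 2) * dot Y V - Y 0 * V 0 := by
    simp only [dot] at *
    linear_combination (Y 1 * V 1 + Y 2 * V 2) * hX - (X 1 * V 1 + X 2 * V 2) * hY
      + X 0 * Y 0 * hV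
  have k1 : (X 0 * Y 2 - X 2 * Y 0) * (X 0 * V 2 - X 2 * V 0)
      = (1 - X 1 ^ 2) * dot Y V - Y 1 * V 1 := by
    simp only [dot] at *
    linear_combination (Y 0 * V 0 + Y 2 * V 2) * hX - (X 0 * V 0 + X 2 * V 2) * hY
      + X 1 * Y 1 * hV
  have k2 : (X 0 * Y 1 - X 1 * Y 0) * (X 0 * V 1 - X 1 * V 0)
      = (1 - X 2 ^ 2) * dot Y V - Y 2 * V 2 := by
    simp only [dot] at *
    linear_combination (Y 0 * V 0 + Y 1 * V 1) * hX - (X 0 * V 0 + X 1 * V 1) * hY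
      + X 2 * Y 2 * hV
  simp only [diagForm, planeTrace, planeDet]
  simp only [dot] at *
  linear_combination β * γ * k0 + α * γ * k1 + α * β * k2
    - (α + β + γ) * (α * Y 0 * V 0 + β * Y 1 * V 1 + γ * Y 2 * V 2) * hX

/-- The image of the projection of `W` to the plane orthogonal to `X` under `T - c`, where `T` is
the operator of the diagonal form on that plane and `c` is the eigenvalue that does not belong to
the `i`-th line field. -/
def eigProj (α β γ : ℝ) (i : Fin 2) (W X : Space) : Space :=
  let Y := W - dot X W • X
  ![α * Y 0, β * Y 1, γ * Y 2] - diagForm α β γ X Y • X - coeigval i α β γ X • Y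

theorem eigval_add_coeigval (i : Fin 2) (X : Space) :
    eigval i α β γ X + coeigval i α β γ X = planeTrace α β γ X := by
  rw [← lamMax_add_lamMin]
  unfold eigval coeigval
  split_ifs
  · rw [add_comm]
  · rfl

theorem eigval_mul_coeigval (hαβ : β < α) (hβγ : γ < β) (i : Fin 2) {X : Space}
    (hX : dot X X = 1) :
    eigval i α β γ X * coeigval i α β γ X = planeDet α β γ X := by
  rw [← lamMax_mul_lamMin hαβ hβγ hX]
  unfold eigval coeigval
  split_ifs
  · rw [mul_comm]
  · rfl

theorem eigval_ne_coeigval (i : Fin 2) {X : Space} (hX : X ∈ regularSphere α β γ) :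
    eigval i α β γ X ≠ coeigval i α β γ X := by
  unfold eigval coeigval
  split_ifs
  exacts [hX.2, hX.2.symm]

theorem continuous_eigval (i : Fin 2) : Continuous (eigval i α β γ) := by
  unfold eigval
  split_ifs
  exacts [continuous_lamMin, continuous_lamMax]

theorem continuous_coeigval (i : Fin 2) : Continuous (coeigval i α β γ) := by
  unfold coeigval
  split_ifs
  exacts [continuous_lamMax, continuous_lamMin]

/-- By Cayley-Hamilton (T - μ)(T - c) = 0 on the plane, so nonzero vectors in the image of T - c are
eigenvectors for μ. -/
theorem eigProj_isEig (hαβ : β < α) (hβγ : γ < β) (i : Fin 2) {X W : Space}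
    (hX : dot X X = 1) (h : eigProj α β γ i W X ≠ 0) :
    IsEig α β γ X (eigval i α β γ X) (eigProj α β γ i W X) := by
  have hsum := eigval_add_coeigval (α := α) (β := β) (γ := γ) i X
  have hmul := eigval_mul_coeigval hαβ hβγ i hX
  refine ⟨h, ?_, fun V hV => ?_⟩
  all_goals
    obtain ⟨Y, hY⟩ : ∃ Y, Y = W - dot X W • X := ⟨_, rfl⟩
    have hXY : dot X Y = 0 := by
      rw [hY]
      simp only [dot, Pi.sub_apply, Pi.smul_apply, smul_eq_mul] at *
      linear_combination (-(X 0 * W 0 + X 1 * W 1 + X 2 * W 2)) * hX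
    have hZ : eigProj α β γ i W X = ![α * Y 0, β * Y 1, γ * Y 2] - diagForm α β γ X Y • X
        - coeigval i α β γ X • Y := by rw [hY]; rfl
    rw [hZ]
  · simp only [dot, diagForm, Pi.sub_apply, Pi.smul_apply, smul_eq_mul, Matrix.cons_val_zero,
      Matrix.cons_val_one, Matrix.cons_val] at *
    linear_combination (-(α * X 0 * Y 0 + β * X 1 * Y 1 + γ * X 2 * Y 2)) * hX
      - coeigval i α β γ X * hXY
  · have ch := plane_cayley_hamilton (α := α) (β := β) (γ := γ) hX hXY hV
    rw [← hsum, ← hmul] at ch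
    simp only [dot, diagForm, Pi.sub_apply, Pi.smul_apply, smul_eq_mul, Matrix.cons_val_zero,
      Matrix.cons_val_one, Matrix.cons_val] at *
    linear_combination ch + eigval i α β γ X * (α * X 0 * Y 0 + β * X 1 * Y 1 + γ * X 2 * Y 2) * hV

/-- After division by the nonzero difference of the eigenvalues, `eigProj` extends a given
eigenvector continuously to nearby points. -/
theorem eigProj_self (i : Fin 2) {X W : Space} (hX : dot X X = 1)
    (h : IsEig α β γ X (eigval i α β γ X) W) :
    eigProj α β γ i W X = (eigval i α β γ X - coeigval i α β γ X) • W := by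
  obtain ⟨-, hXW, ρ, h0, h1, h2⟩ := (isEig_iff hX).1 h
  have hρ : diagForm α β γ X W = ρ := by
    simp only [dot, diagForm] at *
    linear_combination X 0 * h0 + X 1 * h1 + X 2 * h2 + ρ * hX + eigval i α β γ X * hXW
  simp only [eigProj, hXW, zero_smul, sub_zero, hρ]
  apply space_ext <;> simp only [Pi.sub_apply, Pi.smul_apply, smul_eq_mul, Matrix.cons_val_zero,
      Matrix.cons_val_one, Matrix.cons_val]
  · linear_combination h0
  · linear_combination h1
  · linear_combination h2

theorem continuous_eigProj (i : Fin 2) (W : Space) : Continuous (eigProj α β γ i W) := by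
  have := continuous_coeigval (α := α) (β := β) (γ := γ) i
  unfold eigProj dot diagForm
  refine Continuous.sub (Continuous.sub ?_ ?_) ?_
  · refine continuous_pi fun j => ?_
    fin_cases j <;> simp <;> fun_prop
  · simp only [Pi.sub_apply, Pi.smul_apply, smul_eq_mul]; fun_prop
  · fun_prop

theorem lamMin_eq_zero_iff (hαβ : β < α) (hβ : 0 < β) (hγ : γ < 0) {X : Space}
    (hX : dot X X = 1) : lamMin α β γ X = 0 ↔ planeDet α β γ X = 0 := by
  have hb := (lam_bounds hαβ (hγ.trans hβ) hX).2.2.1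
  rw [← lamMax_mul_lamMin hαβ (hγ.trans hβ) hX, mul_eq_zero]
  constructor
  · exact Or.inr
  · rintro (h | h)
    · linarith
    · exact h

/-- Eigendirections are limits of eigendirections at points where the form is nondegenerate. -/
theorem IsEig.mem_closure (hαβ : β < α) (hβ : 0 < β) (hγ : γ < 0) (i : Fin 2) {X W : Space}
    (hX : X ∈ regularSphere α β γ) (h : IsEig α β γ X (eigval i α β γ X) W)
    (h0 : lamMin α β γ X = 0) :
    (X, W) ∈ closure {x : Space × Space | x.1 ∈ regularSphere α β γ ∧ lamMin α β γ x.1 ≠ 0 ∧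
      IsEig α β γ x.1 (eigval i α β γ x.1) x.2} := by
  have hβγ := hγ.trans hβ
  have hα : 0 < α := hβ.trans hαβ
  rw [lamMin_eq_zero_iff hαβ hβ hγ hX.1] at h0
  -- Half the gradient of `planeDet` at `X`; it is tangent to the sphere because `planeDet` is
  -- homogeneous and vanishes at `X`. Moving along `V` and normalizing, `planeDet` gets a simple
  -- zero at t = 0, so nearby points of the curve leave the degenerate locus.
  set V : Space := ![β * γ * X 0, α * γ * X 1, α * β * X 2] with hV
  have hXV : dot X V = 0 := by
    rw [← h0]; simp [dot, planeDet, V]; ring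
  have hV0 : V ≠ 0 := by
    intro hV0
    have e0 : β * γ * X 0 = 0 := congrFun hV0 0
    have e1 : α * γ * X 1 = 0 := congrFun hV0 1
    have e2 : α * β * X 2 = 0 := congrFun hV0 2
    have x0 := (mul_eq_zero.1 e0).resolve_left (mul_ne_zero hβ.ne' hγ.ne)
    have x1 := (mul_eq_zero.1 e1).resolve_left (mul_ne_zero hα.ne' hγ.ne)
    have x2 := (mul_eq_zero.1 e2).resolve_left (mul_ne_zero hα.ne' hβ.ne')
    have := hX.1
    simp [dot, x0, x1, x2] at this
  have hVV := dot_self_pos hV0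
  have hn : ∀ t : ℝ, 0 < 1 + t ^ 2 * dot V V := fun t => by positivity
  set F : ℝ → Space := fun t => (√(1 + t ^ 2 * dot V V))⁻¹ • (X + t • V) with hF
  have hFc : Continuous F := by
    refine Continuous.smul (Continuous.inv₀ (by fun_prop) fun t => (Real.sqrt_pos.2 (hn t)).ne')
      (by fun_prop)
  have hF0 : F 0 = X := by simp [F]
  have hF1 : ∀ t, dot (F t) (F t) = 1 := by
    intro t
    have e := Real.sq_sqrt (hn t).le
    have e' := (Real.sqrt_pos.2 (hn t)).ne'
    have : dot (X + t • V) (X + t • V) = 1 + t ^ 2 * dot V V := by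
      have := hX.1
      simp only [dot, Pi.add_apply, Pi.smul_apply, smul_eq_mul] at *
      linear_combination this + 2 * t * hXV
    rw [show dot (F t) (F t) = (√(1 + t ^ 2 * dot V V))⁻¹ ^ 2 * dot (X + t • V) (X + t • V) by
      simp only [F, dot, Pi.smul_apply, smul_eq_mul]; ring, this, inv_pow, e,
      inv_mul_cancel₀ (hn t).ne']
  have hFd : ∀ t, planeDet α β γ (F t)
      = (√(1 + t ^ 2 * dot V V))⁻¹ ^ 2 * (t * (2 * dot V V + t * planeDet α β γ V)) := by
    intro t
    have : planeDet α β γ (X + t • V) = t * (2 * dot V V + t * planeDet α β γ V) := by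
      have e : β * γ * X 0 * V 0 + α * γ * X 1 * V 1 + α * β * X 2 * V 2 = dot V V := by
        simp [dot, V]
      simp only [planeDet, Pi.add_apply, Pi.smul_apply, smul_eq_mul] at *
      linear_combination h0 + 2 * t * e
    rw [← this]
    simp only [F, planeDet, Pi.smul_apply, smul_eq_mul]; ring
  have hd := sub_ne_zero.2 (eigval_ne_coeigval i hX)
  set c := eigval i α β γ X - coeigval i α β γ X
  have hE : Continuous fun t => eigProj α β γ i W (F t) := (continuous_eigProj i W).comp hFc
  have hG : Continuous fun t => c⁻¹ • eigProj α β γ i W (F t) := hE.const_smul c⁻¹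
  have hG0 : c⁻¹ • eigProj α β γ i W (F 0) = W := by
    rw [hF0, eigProj_self i hX.1 h, smul_smul, inv_mul_cancel₀ hd, one_smul]
  have hlim : Filter.Tendsto (fun t => (F t, c⁻¹ • eigProj α β γ i W (F t))) (nhdsWithin 0 {0}ᶜ)
      (nhds (X, W)) := by
    have := (hFc.prodMk hG).tendsto 0
    rw [hG0, hF0] at this
    exact this.mono_left nhdsWithin_le_nhds
  refine mem_closure_of_tendsto hlim ?_
  have ev1 : ∀ᶠ t in nhds (0 : ℝ), lamMin α β γ (F t) ≠ lamMax α β γ (F t) := by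
    have c1 : Continuous fun t => lamMin α β γ (F t) - lamMax α β γ (F t) :=
      (continuous_lamMin.comp hFc).sub (continuous_lamMax.comp hFc)
    have := c1.continuousAt.eventually_ne (x := 0) (y := 0) (by
      rw [hF0]; exact sub_ne_zero.2 hX.2)
    filter_upwards [this] with t ht using sub_ne_zero.1 ht
  have ev2 : ∀ᶠ t in nhds (0 : ℝ), c⁻¹ • eigProj α β γ i W (F t) ≠ 0 :=
    hG.continuousAt.eventually_ne (by rw [hG0]; exact h.1)
  have ev3 : ∀ᶠ t in nhds (0 : ℝ), 2 * dot V V + t * planeDet α β γ V ≠ 0 := by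
    have c1 : Continuous fun t : ℝ => 2 * dot V V + t * planeDet α β γ V := by fun_prop
    exact c1.continuousAt.eventually_ne (by simpa using hVV.ne')
  filter_upwards [nhdsWithin_le_nhds ev1, nhdsWithin_le_nhds ev2, nhdsWithin_le_nhds ev3,
    self_mem_nhdsWithin] with t h1 h2 h3 h4
  refine ⟨⟨hF1 t, h1⟩, ?_, h2, ?_⟩
  · rw [ne_eq, lamMin_eq_zero_iff hαβ hβ hγ (hF1 t), hFd]
    have := (Real.sqrt_pos.2 (hn t)).ne'
    exact mul_ne_zero (pow_ne_zero _ (inv_ne_zero this)) (mul_ne_zero h4 h3)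
  · have he : eigProj α β γ i W (F t) ≠ 0 := fun he => h2 (by rw [he, smul_zero])
    obtain ⟨-, k1, k2⟩ := eigProj_isEig hαβ hβγ i (hF1 t) he
    refine ⟨?_, fun V hV => ?_⟩
    · simp only [dot, Pi.smul_apply, smul_eq_mul] at k1 ⊢
      linear_combination c⁻¹ * k1
    · have := k2 V hV
      simp only [dot, diagForm, Pi.smul_apply, smul_eq_mul] at this ⊢
      linear_combination c⁻¹ * this

/-- On the closure of a set of eigendirections the eigenvalue equation persists. -/
theorem isEig_of_mem_closure (i : Fin 2) {X W : Space} {S : Set (Space × Space)}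
    (hS : ∀ x ∈ S, dot x.1 x.1 = 1 ∧ IsEig α β γ x.1 (eigval i α β γ x.1) x.2)
    (h : (X, W) ∈ closure S) (hW : W ≠ 0) : IsEig α β γ X (eigval i α β γ X) W := by
  have hc := continuous_eigval (α := α) (β := β) (γ := γ) i
  -- Testing against projections of arbitrary vectors `U`, instead of vectors orthogonal to a
  -- varying point, makes the condition visibly closed.
  set C : Set (Space × Space) := {x | dot x.1 x.2 = 0 ∧ ∀ U,
    diagForm α β γ x.2 (U - dot x.1 U • x.1) = eigval i α β γ x.1 * dot x.2 U} with hC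
  have hcl : IsClosed C := by
    rw [hC, Set.ofPred_and, Set.ofPred_forall]
    have hc' : Continuous fun x : Space × Space => eigval i α β γ x.1 := hc.comp continuous_fst
    refine IsClosed.inter (isClosed_eq ?_ continuous_const) (isClosed_iInter fun U =>
      isClosed_eq ?_ ?_)
    · unfold dot; fun_prop
    · unfold diagForm dot
      simp only [Pi.sub_apply, Pi.smul_apply, smul_eq_mul]; fun_prop
    · exact hc'.mul (by unfold dot; fun_prop)
  have hSC : S ⊆ C := by
    rintro x hx
    obtain ⟨h1, h2, h3, h4⟩ := hS x hx
    refine ⟨h3, fun U => ?_⟩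
    rw [h4]
    · congr 1
      simp only [dot, Pi.sub_apply, Pi.smul_apply, smul_eq_mul] at *
      linear_combination (-(x.1 0 * U 0 + x.1 1 * U 1 + x.1 2 * U 2)) * h3
    · simp only [dot, Pi.sub_apply, Pi.smul_apply, smul_eq_mul] at *
      linear_combination (-(x.1 0 * U 0 + x.1 1 * U 1 + x.1 2 * U 2)) * h1
  obtain ⟨h1, h2⟩ := closure_minimal hSC hcl h
  refine ⟨hW, h1, fun V hV => ?_⟩
  have := h2 V
  simp only at hV this
  rwa [hV, zero_smul, sub_zero] at this

end Eig

/-! ### Surfaces that are affine images of the unit sphere -/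

theorem eq_of_affine_sphere {φ : Space → ℝ} {o : Space} {L : Space ≃L[ℝ] Space} {κ : ℝ}
    (h : ∀ X, φ (o + L X) = κ * (dot X X - 1)) :
    φ = fun p => κ * (dot (L.symm (p - o)) (L.symm (p - o)) - 1) := by
  funext p
  rw [← h]; simp

theorem differentiable_of_affine_sphere {φ : Space → ℝ} {o : Space} {L : Space ≃L[ℝ] Space} {κ : ℝ}
    (h : ∀ X, φ (o + L X) = κ * (dot X X - 1)) : Differentiable ℝ φ := by
  rw [eq_of_affine_sphere h]
  unfold dot
  have : Differentiable ℝ fun p => L.symm (p - o) :=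
    L.symm.differentiable.comp (differentiable_id.sub_const o)
  have hi : ∀ i, Differentiable ℝ fun p => L.symm (p - o) i := differentiable_pi.1 this
  have h0 := hi 0
  have h1 := hi 1
  have h2 := hi 2
  fun_prop

theorem fderiv_of_affine_sphere {φ : Space → ℝ} {o : Space} {L : Space ≃L[ℝ] Space} {κ : ℝ}
    (h : ∀ X, φ (o + L X) = κ * (dot X X - 1)) (X W : Space) :
    fderiv ℝ φ (o + L X) (L W) = 2 * κ * dot X W := by
  have hl : HasDerivAt (fun t : ℝ => o + L X + t • L W) (L W) 0 := by
    simpa using ((hasDerivAt_id (0 : ℝ)).smul_const (L W)).const_add (o + L X)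
  have hf : HasFDerivAt φ (fderiv ℝ φ (o + L X)) (o + L X + (0 : ℝ) • L W) := by
    rw [zero_smul, add_zero]; exact (differentiable_of_affine_sphere h _).hasFDerivAt
  have h1 := hf.comp_hasDerivAt (0 : ℝ) hl
  have h2 : HasDerivAt (fun t : ℝ => κ * (dot X X - 1 + 2 * dot X W * t + dot W W * t ^ 2))
      (2 * κ * dot X W) 0 := by
    have := ((((hasDerivAt_id (0 : ℝ)).const_mul (2 * dot X W)).const_add (dot X X - 1)).add
      (((hasDerivAt_id (0 : ℝ)).pow 2).const_mul (dot W W))).const_mul κ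
    refine this.congr_deriv ?_
    norm_num
    ring
  refine h1.unique (h2.congr_of_eventuallyEq (Filter.Eventually.of_forall fun t => ?_))
  change φ (o + L X + t • L W) = _
  rw [add_assoc, ← map_smul, ← map_add, h]
  simp only [dot, Pi.add_apply, Pi.smul_apply, smul_eq_mul]
  ring

theorem isTangent_of_affine_sphere {φ : Space → ℝ} {o : Space} {L : Space ≃L[ℝ] Space} {κ : ℝ}
    (h : ∀ X, φ (o + L X) = κ * (dot X X - 1)) (hκ : κ ≠ 0) (X W : Space) :
    IsTangent φ (o + L X) (L W) ↔ dot X W = 0 := by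
  rw [IsTangent, fderiv_of_affine_sphere h, mul_eq_zero]
  exact or_iff_right (mul_ne_zero two_ne_zero hκ)

/-- In the affine coordinates given by `o` and `L` the surface `φ = 0` is the unit sphere, and the
Lorentzian inner product is diagonal. -/
structure NormalForm (φ : Space → ℝ) (o : Space) (L : Space ≃L[ℝ] Space) (κ α β γ : ℝ) :
    Prop where
  κ_pos : 0 < κ
  lt : β < α
  pos : 0 < β
  neg : γ < 0
  eq : ∀ X, φ (o + L X) = κ * (dot X X - 1)
  inn_eq : ∀ U V, inn (L U) (L V) = diagForm α β γ U V

namespace NormalForm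

variable {φ : Space → ℝ} {o : Space} {L : Space ≃L[ℝ] Space} {κ α β γ : ℝ}

theorem lt' (h : NormalForm φ o L κ α β γ) : γ < β := h.neg.trans h.pos

theorem pos' (h : NormalForm φ o L κ α β γ) : 0 < α := h.pos.trans h.lt

theorem exists_eq (o : Space) (L : Space ≃L[ℝ] Space) (p : Space) : ∃ X, p = o + L X :=
  ⟨L.symm (p - o), by simp⟩

theorem mem_zeroSet (h : NormalForm φ o L κ α β γ) (X : Space) :
    o + L X ∈ zeroSet φ ↔ dot X X = 1 := by
  change φ (o + L X) = 0 ↔ _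
  rw [h.eq, mul_eq_zero, sub_eq_zero]
  exact or_iff_right h.κ_pos.ne'

theorem fderiv_apply (h : NormalForm φ o L κ α β γ) (X W : Space) :
    fderiv ℝ φ (o + L X) (L W) = 2 * κ * dot X W :=
  fderiv_of_affine_sphere h.eq X W

theorem isTangent_iff (h : NormalForm φ o L κ α β γ) (X W : Space) :
    IsTangent φ (o + L X) (L W) ↔ dot X W = 0 :=
  isTangent_of_affine_sphere h.eq h.κ_pos.ne' X W

theorem forall_tangent (h : NormalForm φ o L κ α β γ) (X : Space) {P : Space → Prop} :
    (∀ w, IsTangent φ (o + L X) w → P w) ↔ ∀ W, dot X W = 0 → P (L W) := by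
  constructor
  · exact fun H W hW => H _ ((h.isTangent_iff X W).2 hW)
  · intro H w hw
    obtain ⟨W, rfl⟩ := L.surjective w
    exact H W ((h.isTangent_iff X W).1 hw)

/-- The linear part of the Lorentzian gradient, in affine coordinates. -/
def gradMap (κ α β γ : ℝ) : Space →L[ℝ] Space :=
  LinearMap.toContinuousLinearMap
    (Matrix.toLin' (Matrix.diagonal ![2 * κ / α, 2 * κ / β, 2 * κ / γ]))

theorem gradMap_apply (κ α β γ : ℝ) (X : Space) :
    gradMap κ α β γ X = ![2 * κ / α * X 0, 2 * κ / β * X 1, 2 * κ / γ * X 2] := by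
  apply space_ext <;> simp [gradMap, Matrix.mulVec_diagonal]

theorem diagForm_gradMap (h : NormalForm φ o L κ α β γ) (X W : Space) :
    diagForm α β γ (gradMap κ α β γ X) W = 2 * κ * dot X W := by
  have h1 := h.pos'.ne'
  have h2 := h.pos.ne'
  have h3 := h.neg.ne
  simp only [gradMap_apply, diagForm, dot, Matrix.cons_val_zero, Matrix.cons_val_one,
    Matrix.cons_val]
  field_simp

/-- The diagonal form is nondegenerate, so the gradient is determined by its products with all
vectors. -/
theorem grad_apply (h : NormalForm φ o L κ α β γ) (X : Space) :
    grad φ (o + L X) = L (gradMap κ α β γ X) := by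
  obtain ⟨U, hU⟩ := L.surjective (grad φ (o + L X))
  have h1 := h.pos'.ne'
  have h2 := h.pos.ne'
  have h3 := h.neg.ne
  have key : ∀ W, diagForm α β γ U W = diagForm α β γ (gradMap κ α β γ X) W := by
    intro W
    rw [h.diagForm_gradMap, ← h.inn_eq, hU, inn_grad, h.fderiv_apply]
  rw [← hU]
  congr 1
  apply space_ext
  · have := key ![1, 0, 0]
    simpa [diagForm, h1] using this
  · have := key ![0, 1, 0]
    simpa [diagForm, h2] using this
  · have := key ![0, 0, 1]
    simpa [diagForm, h3] using this

theorem hasFDerivAt_grad (h : NormalForm φ o L κ α β γ) (p : Space) :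
    HasFDerivAt (grad φ) ((L : Space →L[ℝ] Space) ∘L gradMap κ α β γ ∘L
      (L.symm : Space →L[ℝ] Space)) p := by
  have : grad φ = fun p => ((L : Space →L[ℝ] Space) ∘L gradMap κ α β γ ∘L
      (L.symm : Space →L[ℝ] Space)) (p - o) := by
    funext p
    obtain ⟨X, rfl⟩ := exists_eq o L p
    rw [h.grad_apply]
    simp
  rw [this]
  exact ((ContinuousLinearMap.hasFDerivAt _).comp p ((hasFDerivAt_id p).sub_const o))

theorem fderiv_grad_apply (h : NormalForm φ o L κ α β γ) (p W : Space) :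
    fderiv ℝ (grad φ) p (L W) = L (gradMap κ α β γ W) := by
  rw [(h.hasFDerivAt_grad p).fderiv]; simp

/-- The key simplification: the second form is definite and round, with the same factor at every
point, and only the first form is left to diagonalize. -/
theorem weightedForm_apply (h : NormalForm φ o L κ α β γ) (p W V : Space) :
    weightedForm φ p (L W) (L V) = -(2 * κ) * dot W V := by
  rw [weightedForm, h.fderiv_grad_apply, h.inn_eq, h.diagForm_gradMap]; ring

theorem inn_grad_self (h : NormalForm φ o L κ α β γ) (X : Space) :
    inn (grad φ (o + L X)) (grad φ (o + L X))
      = 4 * κ ^ 2 / (α * β * γ) * planeDet α β γ X := by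
  have h1 := h.pos'.ne'
  have h2 := h.pos.ne'
  have h3 := h.neg.ne
  rw [h.grad_apply, h.inn_eq, h.diagForm_gradMap, gradMap_apply]
  simp only [dot, planeDet, Matrix.cons_val_zero, Matrix.cons_val_one, Matrix.cons_val]
  field_simp
  ring

/-- The factor between the second fundamental form and the Euclidean inner product. -/
def normalFactor (φ : Space → ℝ) (κ : ℝ) (p : Space) : ℝ :=
  -(2 * κ) * ((SignType.sign (inn (grad φ p) (grad φ p)) : ℝ) / mnorm (grad φ p))

/-- Since αβγ < 0, the sign of ⟨ν, ν⟩ is opposite to that of `planeDet`; the factor -2κ reverses it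
once more. -/
theorem normalFactor_pos_iff (h : NormalForm φ o L κ α β γ) (X : Space) :
    (0 < planeDet α β γ X → 0 < normalFactor φ κ (o + L X)) ∧
      (planeDet α β γ X < 0 → normalFactor φ κ (o + L X) < 0) := by
  have hs : 4 * κ ^ 2 / (α * β * γ) < 0 :=
    div_neg_of_pos_of_neg (by have := h.κ_pos; positivity)
      (mul_neg_of_pos_of_neg (mul_pos h.pos' h.pos) h.neg)
  have hκ := h.κ_pos
  constructor
  · intro hd
    have hneg := mul_neg_of_neg_of_pos hs hd
    rw [← h.inn_grad_self] at hneg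
    have : 0 < mnorm (grad φ (o + L X)) := Real.sqrt_pos.2 (abs_pos.2 hneg.ne)
    rw [normalFactor, sign_neg hneg, mul_div_assoc']
    apply div_pos _ this
    simp [hκ]
  · intro hd
    have hneg := mul_pos_of_neg_of_neg hs hd
    rw [← h.inn_grad_self] at hneg
    have : 0 < mnorm (grad φ (o + L X)) := Real.sqrt_pos.2 (abs_pos.2 hneg.ne')
    rw [normalFactor, sign_pos hneg, mul_div_assoc']
    apply div_neg_of_neg_of_pos _ this
    simp [hκ]

/-- Differentiating the normalizing factor of the Gauss map contributes only a multiple of ν, which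
is orthogonal to tangent vectors. -/
theorem secondForm_apply (h : NormalForm φ o L κ α β γ) {X W V : Space} (hV : dot X V = 0)
    (hd : planeDet α β γ X ≠ 0) :
    secondForm φ (o + L X) (L W) (L V) = normalFactor φ κ (o + L X) * dot W V := by
  set p := o + L X with hp
  have hG := h.hasFDerivAt_grad p
  have hne : inn (grad φ p) (grad φ p) ≠ 0 := by
    rw [h.inn_grad_self]
    have h1 := h.pos'.ne'
    have h2 := h.pos.ne'
    have h3 := h.neg.ne
    have h4 := h.κ_pos.ne'
    positivity
  have hI : DifferentiableAt ℝ (fun q => inn (grad φ q) (grad φ q)) p := by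
    have hi := differentiableAt_pi.1 hG.differentiableAt
    have h0 := hi 0
    have h1 := hi 1
    have h2 := hi 2
    unfold inn
    fun_prop
  set f : Space → ℝ := fun q =>
    (SignType.sign (inn (grad φ q) (grad φ q)) : ℝ) / mnorm (grad φ q) with hf
  have hfd : DifferentiableAt ℝ f p := by
    -- Off the tropic the sign of ⟨ν, ν⟩ is locally constant.
    have hev : f =ᶠ[nhds p] fun q => (SignType.sign (inn (grad φ p) (grad φ p)) : ℝ) /
        √|inn (grad φ q) (grad φ q)| := by
      rcases lt_or_gt_of_ne hne with hlt | hlt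
      · filter_upwards [hI.continuousAt.eventually_lt continuousAt_const hlt] with q hq
        simp only [hf, mnorm]
        rw [sign_neg hlt, sign_neg hq]
      · filter_upwards [continuousAt_const.eventually_lt hI.continuousAt hlt] with q hq
        simp only [hf, mnorm]
        rw [sign_pos hlt, sign_pos hq]
    refine DifferentiableAt.congr_of_eventuallyEq ?_ hev
    simp only [div_eq_mul_inv]
    exact (differentiableAt_const _).mul (((hI.abs hne).sqrt (abs_ne_zero.2 hne)).fun_inv
      (Real.sqrt_pos.2 (abs_pos.2 hne)).ne')
  have hN : HasFDerivAt (gaussMap φ) _ p := hfd.hasFDerivAt.smul hG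
  have hν : inn (grad φ p) (L V) = 0 := by
    rw [inn_grad, hp, h.fderiv_apply, hV, mul_zero]
  rw [secondForm, hN.fderiv]
  have e : ∀ (a b : ℝ) (u v w : Space), inn (a • u + b • v) w = a * inn u w + b * inn v w := by
    intros
    simp only [inn, Pi.add_apply, Pi.smul_apply, smul_eq_mul]; ring
  have e2 : (f p • ((L : Space →L[ℝ] Space) ∘L gradMap κ α β γ ∘L
      (L.symm : Space →L[ℝ] Space)) + (fderiv ℝ f p).smulRight (grad φ p)) (L W)
      = f p • L (gradMap κ α β γ W) + fderiv ℝ f p (L W) • grad φ p := by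
    simp
  rw [e2, e, hν, h.inn_eq, h.diagForm_gradMap, normalFactor]
  ring

/-! ### The principal configuration in affine coordinates -/

theorem mem_umbilicSet (h : NormalForm φ o L κ α β γ) (X : Space) :
    o + L X ∈ umbilicSet φ ↔ dot X X = 1 ∧ lamMin α β γ X = lamMax α β γ X := by
  have hκ := h.κ_pos
  change o + L X ∈ zeroSet φ ∧ _ ↔ _
  rw [h.mem_zeroSet]
  refine and_congr_right fun hX => ?_
  constructor
  · rintro ⟨c, hc⟩
    have hc' : ∀ W V, dot X W = 0 → dot X V = 0 →
        -(2 * κ) * dot W V = c * diagForm α β γ W V := by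
      intro W V hW hV
      rw [← h.weightedForm_apply (o + L X), ← h.inn_eq]
      exact hc _ _ ((h.isTangent_iff X W).2 hW) ((h.isTangent_iff X V).2 hV)
    by_contra hne
    -- Evaluated on eigenvectors, proportionality of the forms makes c times either eigenvalue equal
    -- to -2κ ≠ 0, so the eigenvalues coincide.
    have hval : ∀ i, -(2 * κ) = c * eigval i α β γ X := by
      intro i
      obtain ⟨W, hW0, hW1, hW2⟩ := exists_isEig h.lt h.lt' i ⟨hX, hne⟩
      have := hc' W W hW1 hW1
      rw [hW2 W hW1] at this
      exact mul_right_cancel₀ (dot_self_pos hW0).ne' (this.trans (by ring))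
    have h0 := hval 0
    have h1 := hval 1
    have hc0 : c ≠ 0 := by rintro rfl; linarith
    exact hne (mul_left_cancel₀ hc0 (h0.symm.trans h1))
  · intro he
    refine ⟨-(2 * κ) / β, fun w w' hw hw' => ?_⟩
    obtain ⟨W, rfl⟩ := L.surjective w
    obtain ⟨V, rfl⟩ := L.surjective w'
    rw [h.weightedForm_apply, h.inn_eq, diagForm_eq_of_umbilic h.lt h.lt' hX he
      ((h.isTangent_iff X W).1 hw) ((h.isTangent_iff X V).1 hw')]
    have := h.pos.ne'
    field_simp

/-- As the weighted form is definite, a principal direction is an eigendirection of a Euclidean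
self-adjoint operator, and the orthogonal direction X × W is then principal too. -/
theorem lightlikePrincipalLocus_eq_empty (h : NormalForm φ o L κ α β γ) :
    lightlikePrincipalLocus φ = ∅ := by
  rw [Set.eq_empty_iff_forall_notMem]
  rintro p ⟨hp, w, ⟨hw0, hw1, hw2⟩, H⟩
  have hκ := h.κ_pos
  obtain ⟨X, rfl⟩ := exists_eq o L p
  obtain ⟨W, rfl⟩ := L.surjective w
  rw [h.mem_zeroSet] at hp
  rw [h.isTangent_iff] at hw1
  have hW0 : W ≠ 0 := fun hW => hw0 (by rw [hW, map_zero])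
  obtain ⟨hc1, hc2⟩ := cross_ne_zero hp hW0 hw1
  have key : ∀ U V, dot X U = 0 → dot X V = 0 →
      diagForm α β γ W U * dot W V = diagForm α β γ W V * dot W U := by
    intro U V hU hV
    have := hw2 (L U) (L V) ((h.isTangent_iff X U).2 hU) ((h.isTangent_iff X V).2 hV)
    rw [h.weightedForm_apply, h.weightedForm_apply, h.inn_eq, h.inn_eq] at this
    have h2 : -(2 * κ) ≠ 0 := by linarith
    exact mul_left_cancel₀ h2 (by linear_combination this)
  have hWe : IsEig α β γ X (diagForm α β γ W W / dot W W) W := by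
    refine ⟨hW0, hw1, fun V hV => ?_⟩
    have := key W V hw1 hV
    have hn := (dot_self_pos hW0).ne'
    field_simp
    linear_combination -this
  have hCe := hWe.cross hp
  obtain ⟨s, hs⟩ := H (L (cross X W)) ⟨fun hc => hc2 (L.map_eq_zero_iff.1 hc),
    (h.isTangent_iff X _).2 (dot_cross_left X W), fun w₁ w₂ hw₁ hw₂ => by
      obtain ⟨U, rfl⟩ := L.surjective w₁
      obtain ⟨V, rfl⟩ := L.surjective w₂
      rw [h.isTangent_iff] at hw₁ hw₂
      rw [h.weightedForm_apply, h.weightedForm_apply, h.inn_eq, h.inn_eq, hCe.2.2 U hw₁,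
        hCe.2.2 V hw₂]
      ring⟩
  rw [← map_smul] at hs
  have hs' := L.injective hs
  have h1 := dot_cross_right X W
  have h2 := dot_self_pos hc2
  rw [hs'] at h1 h2
  simp only [dot, Pi.smul_apply, smul_eq_mul] at h1 h2
  have : s * (s * W 0) * W 0 + s * (s * W 1) * W 1 + s * (s * W 2) * W 2 = 0 := by
    linear_combination s * h1
  linarith

theorem mem_regularPart (h : NormalForm φ o L κ α β γ) (X : Space) :
    o + L X ∈ regularPart φ ↔ X ∈ regularSphere α β γ := by
  rw [regularPart, h.lightlikePrincipalLocus_eq_empty, Set.union_empty, Set.mem_sdiff,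
    h.mem_umbilicSet, h.mem_zeroSet]
  simp only [regularSphere, Set.mem_ofPred_eq]
  tauto

/-- Degeneracy of the metric means that 0 is an eigenvalue, and `lamMax` ≥ β > 0 leaves only
`lamMin`. -/
theorem mem_tropic (h : NormalForm φ o L κ α β γ) (X : Space) :
    o + L X ∈ tropic φ ↔ dot X X = 1 ∧ lamMin α β γ X = 0 := by
  change o + L X ∈ zeroSet φ ∧ _ ↔ _
  rw [h.mem_zeroSet]
  refine and_congr_right fun hX => ?_
  have hb := (lam_bounds h.lt h.lt' hX).2.2.1
  have hpos := h.pos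
  constructor
  · rintro ⟨w, hw0, hw1, hw2⟩
    obtain ⟨W, rfl⟩ := L.surjective w
    have hW0 : W ≠ 0 := fun hW => hw0 (by rw [hW, map_zero])
    have : IsEig α β γ X 0 W := ⟨hW0, (h.isTangent_iff X W).1 hw1, fun V hV => by
      rw [zero_mul, ← h.inn_eq]; exact hw2 _ ((h.isTangent_iff X V).2 hV)⟩
    rcases this.eq_or h.lt h.lt' hX with e | e
    · linarith
    · exact e.symm
  · intro h0
    obtain ⟨W, hW0, hW1, hW2⟩ := exists_isEig h.lt h.lt' 0
      (show X ∈ regularSphere α β γ from ⟨hX, by linarith⟩)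
    refine ⟨L W, fun hc => hW0 (L.map_eq_zero_iff.1 hc), (h.isTangent_iff X W).2 hW1, ?_⟩
    rw [h.forall_tangent X (P := fun w' => inn (L W) w' = 0)]
    intro V hV
    rw [h.inn_eq, hW2 V hV, show eigval 0 α β γ X = lamMin α β γ X from rfl, h0, zero_mul]

/-- With g the normal factor, II = kI along `W` reads g⟨W,·⟩ = k diag(W,·) with the Euclidean
product on the left. Definiteness excludes k = 0, so the eigenvalue is g/k. -/
theorem isCurvatureVector_iff (h : NormalForm φ o L κ α β γ) {X : Space}
    (hd : planeDet α β γ X ≠ 0) (k : ℝ) (W : Space) :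
    IsCurvatureVector φ (o + L X) k (L W) ↔
      k ≠ 0 ∧ IsEig α β γ X (normalFactor φ κ (o + L X) / k) W := by
  set g := normalFactor φ κ (o + L X) with hg
  have hg0 : g ≠ 0 := by
    rcases lt_or_gt_of_ne hd with hd | hd
    · exact ((h.normalFactor_pos_iff X).2 hd).ne
    · exact ((h.normalFactor_pos_iff X).1 hd).ne'
  rw [IsCurvatureVector, h.isTangent_iff,
    h.forall_tangent X (P := fun w' => secondForm φ (o + L X) (L W) w' = k * inn (L W) w')]
  constructor
  · rintro ⟨hw0, hw1, hw2⟩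
    have hW0 : W ≠ 0 := fun hW => hw0 (by rw [hW, map_zero])
    have hk : k ≠ 0 := by
      rintro rfl
      have := hw2 W hw1
      rw [h.secondForm_apply hw1 hd, zero_mul] at this
      exact (mul_ne_zero hg0 (dot_self_pos hW0).ne') this
    refine ⟨hk, hW0, hw1, fun V hV => ?_⟩
    have := hw2 V hV
    rw [h.secondForm_apply hV hd, h.inn_eq] at this
    rw [div_mul_eq_mul_div, eq_div_iff hk, hg, this]; ring
  · rintro ⟨hk, hW0, hw1, hw2⟩
    refine ⟨fun hc => hW0 (L.map_eq_zero_iff.1 hc), hw1, fun V hV => ?_⟩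
    rw [h.secondForm_apply hV hd, h.inn_eq, hw2 V hV, ← hg]
    field_simp

theorem isPrincipalCurvature_iff (h : NormalForm φ o L κ α β γ) {X : Space}
    (hX : X ∈ regularSphere α β γ) (hd : planeDet α β γ X ≠ 0) (k : ℝ) :
    IsPrincipalCurvature φ (o + L X) k ↔ k = normalFactor φ κ (o + L X) / lamMin α β γ X ∨
      k = normalFactor φ κ (o + L X) / lamMax α β γ X := by
  set g := normalFactor φ κ (o + L X) with hg
  have hg0 : g ≠ 0 := by
    rcases lt_or_gt_of_ne hd with hd | hd
    · exact ((h.normalFactor_pos_iff X).2 hd).ne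
    · exact ((h.normalFactor_pos_iff X).1 hd).ne'
  have hmul := lamMax_mul_lamMin h.lt h.lt' hX.1
  rw [← hmul] at hd
  have h1 := left_ne_zero_of_mul hd
  have h2 := right_ne_zero_of_mul hd
  rw [hmul] at hd
  constructor
  · rintro ⟨w, hw⟩
    obtain ⟨W, rfl⟩ := L.surjective w
    obtain ⟨hk, hW⟩ := (h.isCurvatureVector_iff hd k W).1 hw
    rcases hW.eq_or h.lt h.lt' hX.1 with e | e
    · right; rw [← e, ← hg]; field_simp
    · left; rw [← e, ← hg]; field_simp
  · have aux : ∀ i, eigval i α β γ X ≠ 0 →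
        IsPrincipalCurvature φ (o + L X) (g / eigval i α β γ X) := by
      intro i hi
      obtain ⟨W, hW⟩ := exists_isEig h.lt h.lt' i hX
      refine ⟨L W, (h.isCurvatureVector_iff hd _ W).2 ⟨div_ne_zero hg0 hi, ?_⟩⟩
      rw [← hg, div_div_cancel₀ hg0]
      exact hW
    rintro (rfl | rfl)
    · exact aux 0 h2
    · exact aux 1 h1

theorem mem_lineFieldOff (h : NormalForm φ o L κ α β γ) (i : Fin 2) (X W : Space) :
    (o + L X, L W) ∈ lineFieldOff φ i ↔ X ∈ regularSphere α β γ ∧ lamMin α β γ X ≠ 0 ∧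
      IsEig α β γ X (eigval i α β γ X) W := by
  change _ ∧ _ ∧ _ ↔ _
  simp only
  rw [h.mem_regularPart, h.mem_tropic]
  refine and_congr_right fun hX => ?_
  rw [not_and, imp_iff_right hX.1]
  refine and_congr_right fun hm => ?_
  have hd : planeDet α β γ X ≠ 0 := fun hd => hm ((lamMin_eq_zero_iff h.lt h.pos h.neg hX.1).2 hd)
  have hM : 0 < lamMax α β γ X := h.pos.trans_le (lam_bounds h.lt h.lt' hX.1).2.2.1
  have hlt : lamMin α β γ X < lamMax α β γ X := lt_of_le_of_ne lamMin_le_lamMax hX.2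
  have hmul := lamMax_mul_lamMin h.lt h.lt' hX.1
  set g := normalFactor φ κ (o + L X) with hg
  -- Where `lamMin` < 0 also g < 0, and the quotients have opposite signs; where `lamMin` > 0 also g
  -- > 0, and the smaller denominator wins. On both sides k₁ belongs to `lamMin`.
  have hgk : g / lamMax α β γ X ≤ g / lamMin α β γ X ∧ g ≠ 0 := by
    rcases lt_or_gt_of_ne hm with hm' | hm'
    · have := (h.normalFactor_pos_iff X).2 (by rw [← hmul]; exact mul_neg_of_pos_of_neg hM hm')
      exact ⟨(div_neg_of_neg_of_pos this hM).le.trans (div_pos_of_neg_of_neg this hm').le, this.ne⟩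
    · have := (h.normalFactor_pos_iff X).1 (by rw [← hmul]; exact mul_pos hM hm')
      exact ⟨div_le_div_of_nonneg_left this.le hm' hlt.le, this.ne'⟩
  obtain ⟨hle, hg0⟩ := hgk
  have hset : {k' | IsPrincipalCurvature φ (o + L X) k'}
      = {g / lamMin α β γ X, g / lamMax α β γ X} := by
    ext k; exact h.isPrincipalCurvature_iff hX hd k
  have hF : IsGreatest {k' | IsPrincipalCurvature φ (o + L X) k'} (g / lamMin α β γ X) := by
    rw [hset]
    refine ⟨Or.inl rfl, ?_⟩
    rintro k (rfl | rfl)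
    exacts [le_rfl, hle]
  have hS : IsLeast {k' | IsPrincipalCurvature φ (o + L X) k'} (g / lamMax α β γ X) := by
    rw [hset]
    refine ⟨Or.inr rfl, ?_⟩
    rintro k (rfl | rfl)
    exacts [hle, le_rfl]
  have hk : ∀ k, (if i = 0 then IsFirstCurvature φ (o + L X) k
      else IsSecondCurvature φ (o + L X) k) ↔ k = g / eigval i α β γ X := by
    intro k
    unfold eigval
    split_ifs
    · exact ⟨fun hk => hk.unique hF, fun hk => hk ▸ hF⟩
    · exact ⟨fun hk => hk.unique hS, fun hk => hk ▸ hS⟩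
  have he : eigval i α β γ X ≠ 0 := by
    unfold eigval
    split_ifs
    exacts [hm, hM.ne']
  simp only [hk, exists_eq_left, h.isCurvatureVector_iff hd, ← hg, div_div_cancel₀ hg0]
  exact and_iff_right (div_ne_zero hg0 he)

/-- The limits on the tropic are exactly the eigendirections there: eigenvectors pass to limits, and
each one on the tropic is a limit from outside it. -/
theorem mem_lineField (h : NormalForm φ o L κ α β γ) (i : Fin 2) (X W : Space) :
    (o + L X, L W) ∈ lineField φ i ↔ X ∈ regularSphere α β γ ∧
      IsEig α β γ X (eigval i α β γ X) W := by
  let e : Space × Space ≃ₜ Space × Space :=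
    (L.toHomeomorph.trans (Homeomorph.addLeft o)).prodCongr L.toHomeomorph
  have he : ∀ X W, e (X, W) = (o + L X, L W) := fun X W => rfl
  set S : Set (Space × Space) := {x | x.1 ∈ regularSphere α β γ ∧ lamMin α β γ x.1 ≠ 0 ∧
      IsEig α β γ x.1 (eigval i α β γ x.1) x.2} with hS
  have hpre : e ⁻¹' lineFieldOff φ i = S := by
    ext ⟨Y, V⟩
    exact h.mem_lineFieldOff i Y V
  have hcl : (o + L X, L W) ∈ closure (lineFieldOff φ i) ↔ (X, W) ∈ closure S := by
    rw [← hpre, ← e.preimage_closure]; rfl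
  change _ ∨ _ ∧ _ ∧ _ ∧ _ ↔ _
  rw [h.mem_lineFieldOff, hcl]
  simp only
  rw [h.mem_regularPart, h.mem_tropic]
  constructor
  · rintro (⟨h1, -, h3⟩ | ⟨h1, -, h3, h4⟩)
    · exact ⟨h1, h3⟩
    · exact ⟨h1, isEig_of_mem_closure i (fun x hx => ⟨hx.1.1, hx.2.2⟩) h4
        fun hW => h3 (by rw [hW, map_zero])⟩
  · rintro ⟨h1, h2⟩
    by_cases h0 : lamMin α β γ X = 0
    · exact Or.inr ⟨h1, ⟨h1.1, h0⟩, fun hc => h2.1 (L.map_eq_zero_iff.1 hc),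
        h2.mem_closure h.lt h.pos h.neg i h1 h0⟩
    · exact Or.inl ⟨h1, h0, h2⟩

theorem isPrincipalCurve_iff (h : NormalForm φ o L κ α β γ) (i : Fin 2) (Γ : ℝ → Space)
    (s t : ℝ) :
    IsPrincipalCurve φ i (fun τ => o + L (Γ τ)) s t ↔ IsEigCurve α β γ i Γ s t := by
  have hc : ContDiffOn ℝ ∞ (fun τ => o + L (Γ τ)) (Set.Ioo s t) ↔
      ContDiffOn ℝ ∞ Γ (Set.Ioo s t) := by
    constructor
    · intro H
      have := L.symm.contDiff.comp_contDiffOn (H.sub (contDiffOn_const (c := o)))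
      refine this.congr fun τ _ => ?_
      simp
    · intro H
      exact contDiffOn_const.add (L.contDiff.comp_contDiffOn H)
  unfold IsPrincipalCurve IsEigCurve
  rw [hc]
  refine and_congr_right fun H => forall₂_congr fun τ hτ => ?_
  have hd : HasDerivAt Γ (deriv Γ τ) τ :=
    ((H.contDiffAt (isOpen_Ioo.mem_nhds hτ)).differentiableAt (by simp)).hasDerivAt
  have hd' : HasDerivAt (fun τ => o + L (Γ τ)) (L (deriv Γ τ)) τ :=
    (L.hasFDerivAt.comp_hasDerivAt τ hd).const_add o
  rw [hd'.deriv, h.mem_lineField]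

theorem mem_leaf (h : NormalForm φ o L κ α β γ) (i : Fin 2) (X X' : Space) :
    o + L X' ∈ leaf φ i (o + L X) ↔ X ∈ regularSphere α β γ ∧ X' ∈ regularSphere α β γ ∧
      coeigval i α β γ X = coeigval i α β γ X' ∧
      SignType.sign (X (signCoord i)) = SignType.sign (X' (signCoord i)) := by
  rw [← exists_isEigCurve_iff h.lt h.lt' i]
  constructor
  · rintro ⟨Γ, s, t, hΓ, ⟨a, ha, haX⟩, ⟨b, hb, hbX⟩⟩
    refine ⟨fun τ => L.symm (Γ τ - o), s, t, ?_, ⟨a, ha, ?_⟩, ⟨b, hb, ?_⟩⟩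
    · rw [← h.isPrincipalCurve_iff]; simpa using hΓ
    · simp [haX]
    · simp [hbX]
  · rintro ⟨Γ, s, t, hΓ, ⟨a, ha, rfl⟩, ⟨b, hb, rfl⟩⟩
    exact ⟨fun τ => o + L (Γ τ), s, t, (h.isPrincipalCurve_iff i Γ s t).2 hΓ, ⟨a, ha, rfl⟩,
      ⟨b, hb, rfl⟩⟩

end NormalForm

/-! ### The normal form of an ellipsoid -/

/-! ### Simultaneous diagonalization of symmetric matrices. -/

section Matrices

open Matrix

theorem exists_orthogonal_diagonalization {n : Type*} [Fintype n] [DecidableEq n]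
    {A : Matrix n n ℝ} (hA : A.IsHermitian) :
    ∃ (U : Matrix n n ℝ) (d : n → ℝ), Uᵀ * U = 1 ∧ Uᵀ * A * U = diagonal d := by
  refine ⟨hA.eigenvectorUnitary, hA.eigenvalues, ?_, ?_⟩
  · have := Unitary.coe_star_mul_self hA.eigenvectorUnitary
    rwa [star_eq_conjTranspose, conjTranspose_eq_transpose_of_trivial] at this
  · have := hA.conjStarAlgAut_star_eigenvectorUnitary
    rwa [Unitary.conjStarAlgAut_star_apply, star_eq_conjTranspose,
      conjTranspose_eq_transpose_of_trivial] at this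

/-- A symmetric matrix and a positive definite one are simultaneously diagonalized by a
congruence. -/
theorem exists_simultaneous_diagonalization {n : Type*} [Fintype n] [DecidableEq n]
    {H J : Matrix n n ℝ} (hH : H.PosDef) (hJ : J.IsSymm) :
    ∃ (C : Matrix n n ℝ) (d : n → ℝ), Cᵀ * H * C = 1 ∧ Cᵀ * J * C = diagonal d := by
  obtain ⟨U, e, hU, he⟩ := exists_orthogonal_diagonalization hH.isHermitian
  have hUinj : Function.Injective U.mulVec :=
    Function.LeftInverse.injective (g := Uᵀ.mulVec) fun x => by
      rw [mulVec_mulVec, hU, one_mulVec]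
  have hpos : ∀ i, 0 < e i := by
    have := hH.conjTranspose_mul_mul_same hUinj
    rw [conjTranspose_eq_transpose_of_trivial, he] at this
    exact posDef_diagonal_iff.1 this
  -- Congruence by `M` turns `H` into the identity; a further orthogonal congruence keeps it and
  -- diagonalizes the transformed `J`.
  set M := U * diagonal fun i => (√(e i))⁻¹ with hM
  have hMH : Mᵀ * H * M = 1 := by
    rw [hM, transpose_mul, diagonal_transpose, show
      diagonal (fun i => (√(e i))⁻¹) * Uᵀ * H * (U * diagonal fun i => (√(e i))⁻¹)
        = diagonal (fun i => (√(e i))⁻¹) * (Uᵀ * H * U) * diagonal (fun i => (√(e i))⁻¹) by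
          simp only [Matrix.mul_assoc], he, diagonal_mul_diagonal, diagonal_mul_diagonal,
      ← diagonal_one]
    congr 1
    funext i
    have h1 := Real.mul_self_sqrt (hpos i).le
    have h2 := (Real.sqrt_pos.2 (hpos i)).ne'
    field_simp
    linarith
  clear_value M
  have hS : (Mᵀ * J * M).IsHermitian := by
    rw [IsHermitian, conjTranspose_eq_transpose_of_trivial, transpose_mul, transpose_mul,
      transpose_transpose, hJ.eq, Matrix.mul_assoc]
  obtain ⟨V, d, hV, hd⟩ := exists_orthogonal_diagonalization hS
  refine ⟨M * V, d, ?_, ?_⟩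
  · rw [transpose_mul, show Vᵀ * Mᵀ * H * (M * V) = Vᵀ * (Mᵀ * H * M) * V by
      simp only [Matrix.mul_assoc], hMH, Matrix.mul_one, hV]
  · rw [transpose_mul, show Vᵀ * Mᵀ * J * (M * V) = Vᵀ * (Mᵀ * J * M) * V by
      simp only [Matrix.mul_assoc], hd]

/-- The simultaneous diagonalization can be chosen with decreasing eigenvalues. -/
theorem exists_antitone_diagonalization {n : ℕ} {H J : Matrix (Fin n) (Fin n) ℝ}
    (hH : H.PosDef) (hJ : J.IsSymm) :
    ∃ (C : Matrix (Fin n) (Fin n) ℝ) (d : Fin n → ℝ), Antitone d ∧ Cᵀ * H * C = 1 ∧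
      Cᵀ * J * C = diagonal d := by
  obtain ⟨C, d, h1, h2⟩ := exists_simultaneous_diagonalization hH hJ
  set σ := Tuple.sort (-d)
  have key : ∀ A : Matrix (Fin n) (Fin n) ℝ,
      (C.submatrix id σ)ᵀ * A * C.submatrix id σ = (Cᵀ * A * C).submatrix σ σ := by
    intro A
    ext i j
    simp [Matrix.mul_apply]
  refine ⟨C.submatrix id σ, d ∘ σ, ?_, ?_, ?_⟩
  · have := Tuple.monotone_sort (-d)
    intro i j hij
    have h := this hij
    simp only [Function.comp_apply, Pi.neg_apply, neg_le_neg_iff] at h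
    exact h
  · rw [key, h1, submatrix_one_equiv]
  · rw [key, h2, submatrix_diagonal_equiv]

end Matrices

/-! ### Center and diagonal form of an ellipsoid. -/

namespace Quadric

open Matrix

/-- The symmetric matrix of the quadratic part. -/
def matrix (Q : Quadric) : Matrix (Fin 3) (Fin 3) ℝ :=
  !![Q.a, Q.d, Q.e; Q.d, Q.b, Q.f; Q.e, Q.f, Q.c]

theorem dotProduct_matrix (Q : Quadric) (v : Space) : v ⬝ᵥ Q.matrix *ᵥ v = Q.quad v := by
  simp [matrix, quad, dotProduct, mulVec, Fin.sum_univ_three]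
  ring

theorem IsEllipsoid.posDef {Q : Quadric} (h : Q.IsEllipsoid) : Q.matrix.PosDef := by
  refine PosDef.of_dotProduct_mulVec_pos ?_ fun x hx => ?_
  · ext i j; fin_cases i <;> fin_cases j <;> simp [matrix]
  · rw [star_trivial, dotProduct_matrix]; exact h.1 x hx

/-- Completing the square: the center is the critical point of the polynomial, and the minimum there
lies below a negative value. -/
theorem IsEllipsoid.exists_center {Q : Quadric} (h : Q.IsEllipsoid) :
    ∃ o, Q.poly o < 0 ∧ ∀ v, Q.poly (o + v) = Q.quad v + Q.poly o := by
  have hu := (isUnit_iff_isUnit_det _).1 h.posDef.isUnit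
  obtain ⟨o, ho⟩ : ∃ o, Q.matrix *ᵥ o = ![-Q.g / 2, -Q.h / 2, -Q.k / 2] :=
    ⟨Q.matrix⁻¹ *ᵥ _, by rw [mulVec_mulVec, mul_nonsing_inv _ hu, one_mulVec]⟩
  have h0 : Q.a * o 0 + Q.d * o 1 + Q.e * o 2 = -Q.g / 2 := by
    have := congrFun ho 0
    simpa [matrix, mulVec, dotProduct, Fin.sum_univ_three] using this
  have h1 : Q.d * o 0 + Q.b * o 1 + Q.f * o 2 = -Q.h / 2 := by
    have := congrFun ho 1
    simpa [matrix, mulVec, dotProduct, Fin.sum_univ_three] using this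
  have h2 : Q.e * o 0 + Q.f * o 1 + Q.c * o 2 = -Q.k / 2 := by
    have := congrFun ho 2
    simpa [matrix, mulVec, dotProduct, Fin.sum_univ_three] using this
  have key : ∀ v, Q.poly (o + v) = Q.quad v + Q.poly o := by
    intro v
    simp only [poly, quad, Pi.add_apply]
    linear_combination 2 * v 0 * h0 + 2 * v 1 * h1 + 2 * v 2 * h2
  refine ⟨o, ?_, key⟩
  obtain ⟨p, hp⟩ := h.2
  have hq : 0 ≤ Q.quad (p - o) := by
    by_cases hv : p - o = 0
    · rw [hv]; simp [quad]
    · exact (h.1 _ hv).le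
  have := key (p - o)
  rw [add_sub_cancel] at this
  linarith

theorem IsEllipsoid.exists_diagonal {Q : Quadric} (h : Q.IsEllipsoid) :
    ∃ (o : Space) (L : Space ≃L[ℝ] Space) (κ α β γ : ℝ), 0 < κ ∧ β ≤ α ∧ γ ≤ β ∧
      (∀ X, Q.poly (o + L X) = κ * (dot X X - 1)) ∧
      ∀ U V, inn (L U) (L V) = diagForm α β γ U V := by
  obtain ⟨o, hneg, ho⟩ := h.exists_center
  set κ := -Q.poly o with hκ
  have hκ0 : 0 < κ := by linarith
  have hJ : (diagonal ![(1 : ℝ), 1, -1]).IsSymm := isSymm_diagonal _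
  -- Dividing by κ = -q(o) gives the sphere radius 1.
  obtain ⟨C, d, hd, hCH, hCJ⟩ :=
    exists_antitone_diagonalization (h.posDef.smul (inv_pos.2 hκ0)) hJ
  have hC' : C * (Cᵀ * (κ⁻¹ • Q.matrix)) = 1 := mul_eq_one_comm.1 hCH
  have hbil : ∀ (A : Matrix (Fin 3) (Fin 3) ℝ) (U V : Space),
      (C *ᵥ U) ⬝ᵥ A *ᵥ (C *ᵥ V) = U ⬝ᵥ (Cᵀ * A * C) *ᵥ V := by
    intro A U V
    rw [mulVec_mulVec, dotProduct_mulVec, vecMul_mulVec, ← dotProduct_mulVec, Matrix.mul_assoc]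
  obtain ⟨L, hL⟩ : ∃ L : Space ≃L[ℝ] Space, ∀ X, L X = C *ᵥ X :=
    ⟨(Matrix.toLin'OfInv hCH hC').toContinuousLinearEquiv, fun X => by simp [Matrix.toLin'OfInv]⟩
  refine ⟨o, L, κ, d 0, d 1, d 2, hκ0, hd (by decide), hd (by decide), fun X => ?_, fun U V => ?_⟩
  · have h1 := hbil (κ⁻¹ • Q.matrix) X X
    rw [hCH, one_mulVec, smul_mulVec, dotProduct_smul, dotProduct_matrix, smul_eq_mul,
      inv_mul_eq_iff_eq_mul₀ hκ0.ne'] at h1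
    rw [ho, hL, h1, show Q.poly o = -κ by rw [hκ]; ring]
    simp only [dotProduct, Fin.sum_univ_three, dot]
    ring
  · have h1 := hbil (diagonal ![1, 1, -1]) U V
    rw [hCJ] at h1
    simp only [dotProduct, mulVec_diagonal, Fin.sum_univ_three] at h1
    rw [hL, hL, inn, diagForm]
    simp at h1
    linear_combination h1

end Quadric

/-- Sylvester's law of inertia. If β ≤ 0, the form is nonpositive on the plane X₀ = 0, whose image
meets the spacelike plane where the third coordinate vanishes in a nonzero vector. A timelike vector
gives γ < 0. -/
theorem diag_signs {L : Space ≃L[ℝ] Space} {α β γ : ℝ} (hβγ : γ ≤ β)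
    (hαβ : β ≤ α) (h : ∀ U V, inn (L U) (L V) = diagForm α β γ U V) : 0 < β ∧ γ < 0 := by
  constructor
  · by_contra hβ
    push Not at hβ
    have aux : ∀ X, X 0 = 0 → (L X) 2 = 0 → X = 0 := by
      intro X hX hLX
      have h1 := h X X
      simp only [inn, diagForm, hX, hLX] at h1
      have h2 : L X = 0 := by
        apply space_ext <;> simp only [Pi.zero_apply]
        · nlinarith [sq_nonneg (L X 0), sq_nonneg (L X 1), mul_self_nonneg (X 1),
            mul_self_nonneg (X 2)]
        · nlinarith [sq_nonneg (L X 0), sq_nonneg (L X 1), mul_self_nonneg (X 1),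
            mul_self_nonneg (X 2)]
        · exact hLX
      exact L.map_eq_zero_iff.1 h2
    set e₁ : Space := ![0, 1, 0]
    set e₂ : Space := ![0, 0, 1]
    have h1 := aux ((L e₂ 2) • e₁ - (L e₁ 2) • e₂) (by simp [e₁, e₂]) (by
      simp only [map_sub, map_smul, Pi.sub_apply, Pi.smul_apply, smul_eq_mul]; ring)
    have h2 : L e₂ 2 = 0 := by simpa [e₁, e₂] using congrFun h1 1
    have h3 := congrFun (aux e₂ (by simp [e₂]) h2) 2
    simp [e₂] at h3
  · by_contra hγ
    push Not at hγ
    obtain ⟨X, hX⟩ := L.surjective ![0, 0, 1]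
    have h1 := h X X
    rw [hX] at h1
    simp [inn, diagForm] at h1
    nlinarith [mul_self_nonneg (X 0), mul_self_nonneg (X 1), mul_self_nonneg (X 2)]

/-! ### Semi-axes and the separation of α from β. -/

namespace Quadric

/-- A semi-axis at the unique center is a unit eigenvector of the diagonal form, with eigenvalue its
Lorentzian square. -/
theorem semiAxisLengths_subset {Q : Quadric} {o : Space} {L : Space ≃L[ℝ] Space}
    {κ α β γ : ℝ} (hκ : 0 < κ)
    (hQ : ∀ X, Q.poly (o + L X) = κ * (dot X X - 1))
    (hL : ∀ U V, inn (L U) (L V) = diagForm α β γ U V) :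
    Q.semiAxisLengths ⊆ {√|α|, √|β|, √|γ|} := by
  rintro r ⟨o', v, hc, ⟨hv, hn⟩, rfl⟩
  obtain ⟨Y, rfl⟩ := NormalForm.exists_eq o L o'
  obtain ⟨V, rfl⟩ := L.surjective v
  have hY : Y = 0 := by
    have := hc (L Y)
    rw [add_assoc, ← map_add, hQ, add_sub_cancel_right, ← add_zero o, ← map_zero L, hQ] at this
    have h4 := mul_left_cancel₀ hκ.ne' this
    by_contra hY
    have := dot_self_pos hY
    simp only [dot, Pi.add_apply, Pi.zero_apply] at h4 this
    linarith
  subst hY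
  rw [map_zero, add_zero] at hv hn
  have hV : dot V V = 1 := by
    have : κ * (dot V V - 1) = 0 := by rw [← hQ]; exact hv
    have := (mul_eq_zero.1 this).resolve_left hκ.ne'
    linarith
  have hd : ∀ W, dot V W = 0 → diagForm α β γ V W = 0 := fun W hW => by
    rw [← hL]; exact hn _ ((isTangent_of_affine_sphere hQ hκ.ne' V W).2 hW)
  have hproj : ∀ U, diagForm α β γ V U = diagForm α β γ V V * dot V U := by
    intro U
    have := hd (U - dot V U • V) (by
      simp only [dot, Pi.sub_apply, Pi.smul_apply, smul_eq_mul] at *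
      linear_combination (-(V 0 * U 0 + V 1 * U 1 + V 2 * U 2)) * hV)
    simp only [diagForm, Pi.sub_apply, Pi.smul_apply, smul_eq_mul] at this ⊢
    linear_combination this
  rw [mnorm, hL]
  generalize diagForm α β γ V V = m at hproj
  have e0 := hproj ![1, 0, 0]
  have e1 := hproj ![0, 1, 0]
  have e2 := hproj ![0, 0, 1]
  simp [diagForm, dot] at e0 e1 e2
  by_cases v0 : V 0 = 0
  · by_cases v1 : V 1 = 0
    · have v2 : V 2 ≠ 0 := by
        intro v2; simp [dot, v0, v1, v2] at hV
      rw [← e2.resolve_right v2]; simp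
    · rw [← e1.resolve_right v1]; simp
  · rw [← e0.resolve_right v0]; simp

theorem IsEllipsoid.exists_normalForm {Q : Quadric} (h : Q.IsEllipsoid)
    (hA : Q.HasThreeDistinctAxes) :
    ∃ o L κ α β γ, NormalForm Q.poly o L κ α β γ := by
  obtain ⟨o, L, κ, α, β, γ, hκ, hαβ, hβγ, hQ, hL⟩ := h.exists_diagonal
  obtain ⟨hβ, hγ⟩ := diag_signs hβγ hαβ hL
  refine ⟨o, L, κ, α, β, γ, hκ, lt_of_le_of_ne hαβ ?_, hβ, hγ, hQ, hL⟩
  -- With α = β at most two lengths would remain.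
  rintro rfl
  have h1 := Set.ncard_le_ncard (semiAxisLengths_subset hκ hQ hL) (by simp)
  rw [Set.insert_idem] at h1
  have h2 := (Set.ncard_insert_le √|β| {√|γ|})
  rw [Set.ncard_singleton] at h2
  rw [HasThreeDistinctAxes] at hA
  omega

end Quadric

/-! ### The homeomorphism of unit spheres -/

/-- The piecewise linear map of the line that fixes `0` and sends `γ, β, α` to `γ', β', α'`, where
`γ < 0 < β < α`. -/
def matchMap (α β γ α' β' γ' x : ℝ) : ℝ :=
  γ' / γ * min x 0 + β' / β * max 0 (min x β) + (α' - β') / (α - β) * max (x - β) 0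

/-- The map of unit spheres that preserves the signs of the coordinates and acts on both eigenvalues
by `matchMap`. -/
def sphereMap (α β γ α' β' γ' : ℝ) (X : Space) : Space :=
  let u := matchMap α β γ α' β' γ' (lamMax α β γ X)
  let v := matchMap α β γ α' β' γ' (lamMin α β γ X)
  ![SignType.sign (X 0) * √((α' - u) * (α' - v) / ((α' - β') * (α' - γ'))),
    SignType.sign (X 1) * √((u - β') * (β' - v) / ((α' - β') * (β' - γ'))),
    SignType.sign (X 2) * √((u - γ') * (v - γ') / ((α' - γ') * (β' - γ')))]

theorem sq_sign_mul_sqrt {x T : ℝ} (hT : 0 ≤ T) (h : x = 0 → T = 0) :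
    ((SignType.sign x : ℝ) * √T) ^ 2 = T := by
  rcases lt_trichotomy x 0 with hx | hx | hx
  · simp [sign_neg hx, Real.sq_sqrt hT]
  · simp [h hx]
  · simp [sign_pos hx, Real.sq_sqrt hT]

theorem sign_sign_mul_sqrt {x T : ℝ} (hT : 0 ≤ T) (h : T = 0 → x = 0) :
    SignType.sign ((SignType.sign x : ℝ) * √T) = SignType.sign x := by
  by_cases hx : x = 0
  · simp [hx]
  · have : 0 < √T := Real.sqrt_pos.2 (lt_of_le_of_ne hT fun h0 => hx (h h0.symm))
    rcases lt_or_gt_of_ne hx with hx | hx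
    · simp [sign_neg hx, this]
    · simp [sign_pos hx, this]

/-- The jump of the sign is harmless where the other factor vanishes. -/
theorem continuous_sign_mul {Z : Type*} [TopologicalSpace Z] {f g : Z → ℝ} (hf : Continuous f)
    (hg : Continuous g) (h : ∀ z, f z = 0 → g z = 0) :
    Continuous fun z => (SignType.sign (f z) : ℝ) * g z := by
  rw [continuous_iff_continuousAt]
  intro z
  rcases lt_trichotomy (f z) 0 with hz | hz | hz
  · refine hg.neg.continuousAt.congr ?_
    filter_upwards [hf.continuousAt.eventually_lt continuousAt_const hz] with y hy
    simp [sign_neg hy]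
  · have h0 : (SignType.sign (f z) : ℝ) * g z = 0 := by rw [h z hz, mul_zero]
    rw [ContinuousAt, h0]
    have hg0 : Filter.Tendsto (fun y => |g y|) (nhds z) (nhds 0) := by
      have := hg.abs.tendsto z
      rwa [h z hz, abs_zero] at this
    refine squeeze_zero_norm (fun y => ?_) hg0
    rw [Real.norm_eq_abs, abs_mul]
    refine mul_le_of_le_one_left (abs_nonneg _) ?_
    cases SignType.sign (f y) <;> simp
  · refine hg.continuousAt.congr ?_
    filter_upwards [continuousAt_const.eventually_lt hf.continuousAt hz] with y hy
    simp [sign_pos hy]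

/-- The ordering of the coefficients of a diagonalized Lorentzian inner product. -/
structure Ordered (α β γ : ℝ) : Prop where
  lt : β < α
  pos : 0 < β
  neg : γ < 0

section MatchMap

variable {α β γ α' β' γ' : ℝ}

theorem Ordered.lt' (h : Ordered α β γ) : γ < β := h.neg.trans h.pos

theorem matchMap_apply (h : Ordered α β γ) (x : ℝ) : (x ≤ 0 → matchMap α β γ α' β' γ' x
      = γ' / γ * x) ∧ (0 ≤ x → x ≤ β → matchMap α β γ α' β' γ' x = β' / β * x) ∧
    (β ≤ x → matchMap α β γ α' β' γ' x = β' + (α' - β') / (α - β) * (x - β)) := by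
  have hβ := h.pos
  refine ⟨fun h0 => ?_, fun h0 h1 => ?_, fun h0 => ?_⟩
  · rw [matchMap, min_eq_left h0, min_eq_left (h0.trans hβ.le), max_eq_left h0,
      max_eq_right (by linarith)]; ring
  · rw [matchMap, min_eq_right h0, min_eq_left h1, max_eq_right h0,
      max_eq_right (by linarith)]; ring
  · rw [matchMap, min_eq_right (hβ.le.trans h0), min_eq_right h0, max_eq_right hβ.le,
      max_eq_left (by linarith)]; field_simp; ring

theorem matchMap_matchMap (h : Ordered α β γ) (h' : Ordered α' β' γ') (x : ℝ) :
    matchMap α' β' γ' α β γ (matchMap α β γ α' β' γ' x) = x := by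
  obtain ⟨a1, a2, a3⟩ := matchMap_apply (α' := α') (β' := β') (γ' := γ') h x
  have hγ := h.neg
  have hγ' := h'.neg
  have hβ := h.pos
  have hβ' := h'.pos
  have hαβ := sub_pos.2 h.lt
  have hαβ' := sub_pos.2 h'.lt
  rcases le_total x 0 with hx | hx
  · rw [a1 hx, (matchMap_apply h' _).1 (mul_nonpos_of_nonneg_of_nonpos
      (div_nonneg_of_nonpos hγ'.le hγ.le) hx)]
    have := hγ.ne
    have := hγ'.ne
    field_simp
  rcases le_total x β with hx' | hx'
  · rw [a2 hx hx', (matchMap_apply h' _).2.1 (by positivity) (by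
      rw [div_mul_eq_mul_div, div_le_iff₀ hβ]; gcongr)]
    field_simp
  · rw [a3 hx', (matchMap_apply h' _).2.2 (le_add_of_nonneg_right
      (mul_nonneg (div_nonneg hαβ'.le hαβ.le) (by linarith)))]
    have := hαβ.ne'
    have := hαβ'.ne'
    field_simp
    ring

theorem matchMap_injective (h : Ordered α β γ) (h' : Ordered α' β' γ') :
    Function.Injective (matchMap α β γ α' β' γ') :=
  Function.LeftInverse.injective (matchMap_matchMap h h')

theorem matchMap_monotone (h : Ordered α β γ) (h' : Ordered α' β' γ') :
    Monotone (matchMap α β γ α' β' γ') := by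
  intro x y hxy
  have c1 : 0 ≤ γ' / γ := div_nonneg_of_nonpos h'.neg.le h.neg.le
  have c2 : 0 ≤ β' / β := div_nonneg h'.pos.le h.pos.le
  have c3 : 0 ≤ (α' - β') / (α - β) := div_nonneg (sub_pos.2 h'.lt).le (sub_pos.2 h.lt).le
  unfold matchMap
  gcongr

theorem continuous_matchMap : Continuous (matchMap α β γ α' β' γ') := by
  unfold matchMap; fun_prop

/-- γ, β, α bound the ranges of the two eigenvalues and are the values at which coordinates vanish;
the value at 0 carries tropic to tropic. -/
theorem matchMap_values (h : Ordered α β γ) : matchMap α β γ α' β' γ' 0 = 0 ∧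
    matchMap α β γ α' β' γ' γ = γ' ∧ matchMap α β γ α' β' γ' β = β' ∧
    matchMap α β γ α' β' γ' α = α' := by
  have hγ := h.neg.ne
  have hβ := h.pos.ne'
  have hαβ := (sub_pos.2 h.lt).ne'
  refine ⟨?_, ?_, ?_, ?_⟩
  · rw [(matchMap_apply h 0).1 le_rfl, mul_zero]
  · rw [(matchMap_apply h γ).1 h.neg.le]; field_simp
  · rw [(matchMap_apply h β).2.1 h.pos.le le_rfl]; field_simp
  · rw [(matchMap_apply h α).2.2 h.lt.le]; field_simp; ring

end MatchMap

section SphereMap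

variable {α β γ α' β' γ' : ℝ}

/-- The properties of `sphereMap` that determine it. -/
theorem sphereMap_spec (h : Ordered α β γ) (h' : Ordered α' β' γ') {X : Space}
    (hX : dot X X = 1) :
    dot (sphereMap α β γ α' β' γ' X) (sphereMap α β γ α' β' γ' X) = 1 ∧
    lamMax α' β' γ' (sphereMap α β γ α' β' γ' X) = matchMap α β γ α' β' γ' (lamMax α β γ X) ∧
    lamMin α' β' γ' (sphereMap α β γ α' β' γ' X) = matchMap α β γ α' β' γ' (lamMin α β γ X) ∧
    ∀ i, SignType.sign (sphereMap α β γ α' β' γ' X i) = SignType.sign (X i) := by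
  obtain ⟨b1, b2, b3, b4⟩ := lam_bounds h.lt h.lt' hX
  have s1 := first_sq h.lt h.lt' hX
  have s2 := second_sq h.lt h.lt' hX
  have s3 := third_sq h.lt h.lt' hX
  obtain ⟨-, vγ, vβ, vα⟩ := matchMap_values (α' := α') (β' := β') (γ' := γ') h
  have hmono := matchMap_monotone h h'
  have hinj := matchMap_injective h h'
  set U := lamMax α β γ X
  set V := lamMin α β γ X
  obtain ⟨u, hu⟩ : ∃ u, u = matchMap α β γ α' β' γ' U := ⟨_, rfl⟩
  obtain ⟨v, hv⟩ : ∃ v, v = matchMap α β γ α' β' γ' V := ⟨_, rfl⟩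
  have c1 : γ' ≤ v := by rw [← vγ, hv]; exact hmono b1
  have c2 : v ≤ β' := by rw [← vβ, hv]; exact hmono b2
  have c3 : β' ≤ u := by rw [← vβ, hu]; exact hmono b3
  have c4 : u ≤ α' := by rw [← vα, hu]; exact hmono b4
  have d1 : 0 < α' - β' := sub_pos.2 h'.lt
  have d2 : 0 < β' - γ' := sub_pos.2 h'.lt'
  have d3 : 0 < α' - γ' := by linarith
  have d1' : 0 < α - β := sub_pos.2 h.lt
  have d2' : 0 < β - γ := sub_pos.2 h.lt'
  have d3' : 0 < α - γ := by linarith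
  have eα : ∀ {x}, α' - matchMap α β γ α' β' γ' x = 0 ↔ α - x = 0 := fun {x} => by
    rw [sub_eq_zero, sub_eq_zero, ← hinj.eq_iff (a := α), vα]
  have eβ : ∀ {x}, β' - matchMap α β γ α' β' γ' x = 0 ↔ β - x = 0 := fun {x} => by
    rw [sub_eq_zero, sub_eq_zero, ← hinj.eq_iff (a := β), vβ]
  have eβ' : ∀ {x}, matchMap α β γ α' β' γ' x - β' = 0 ↔ x - β = 0 := fun {x} => by
    rw [sub_eq_zero, sub_eq_zero, ← hinj.eq_iff (a := x), vβ]
  have eγ : ∀ {x}, matchMap α β γ α' β' γ' x - γ' = 0 ↔ x - γ = 0 := fun {x} => by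
    rw [sub_eq_zero, sub_eq_zero, ← hinj.eq_iff (a := x), vγ]
  -- A radicand vanishes exactly with its coordinate. This keeps the sign, and it keeps the square,
  -- which the sign 0 would otherwise destroy.
  have z1 : X 0 = 0 ↔ (α' - u) * (α' - v) / ((α' - β') * (α' - γ')) = 0 := by
    rw [div_eq_zero_iff, or_iff_left (mul_pos d1 d3).ne', hu, hv, mul_eq_zero, eα, eα,
      ← mul_eq_zero, ← s1, mul_eq_zero, or_iff_left (mul_pos d1' d3').ne', sq_eq_zero_iff]
  have z2 : X 1 = 0 ↔ (u - β') * (β' - v) / ((α' - β') * (β' - γ')) = 0 := by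
    rw [div_eq_zero_iff, or_iff_left (mul_pos d1 d2).ne', hu, hv, mul_eq_zero, eβ, eβ',
      ← mul_eq_zero, ← s2, mul_eq_zero, or_iff_left (mul_pos d1' d2').ne', sq_eq_zero_iff]
  have z3 : X 2 = 0 ↔ (u - γ') * (v - γ') / ((α' - γ') * (β' - γ')) = 0 := by
    rw [div_eq_zero_iff, or_iff_left (mul_pos d3 d2).ne', hu, hv, mul_eq_zero, eγ, eγ,
      ← mul_eq_zero, ← s3, mul_eq_zero, or_iff_left (mul_pos d3' d2').ne', sq_eq_zero_iff]
  have p1 : 0 ≤ (α' - u) * (α' - v) / ((α' - β') * (α' - γ')) :=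
    div_nonneg (mul_nonneg (by linarith) (by linarith)) (mul_pos d1 d3).le
  have p2 : 0 ≤ (u - β') * (β' - v) / ((α' - β') * (β' - γ')) :=
    div_nonneg (mul_nonneg (by linarith) (by linarith)) (mul_pos d1 d2).le
  have p3 : 0 ≤ (u - γ') * (v - γ') / ((α' - γ') * (β' - γ')) :=
    div_nonneg (mul_nonneg (by linarith) (by linarith)) (mul_pos d3 d2).le
  obtain ⟨Y, hY⟩ : ∃ Y, Y = sphereMap α β γ α' β' γ' X := ⟨_, rfl⟩
  have y0 : Y 0 = SignType.sign (X 0) * √((α' - u) * (α' - v) / ((α' - β') * (α' - γ'))) := by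
    rw [hY, hu, hv]; rfl
  have y1 : Y 1 = SignType.sign (X 1) * √((u - β') * (β' - v) / ((α' - β') * (β' - γ'))) := by
    rw [hY, hu, hv]; rfl
  have y2 : Y 2 = SignType.sign (X 2) * √((u - γ') * (v - γ') / ((α' - γ') * (β' - γ'))) := by
    rw [hY, hu, hv]; rfl
  have q0 := sq_sign_mul_sqrt p1 z1.1
  have q1 := sq_sign_mul_sqrt p2 z2.1
  have q2 := sq_sign_mul_sqrt p3 z3.1
  rw [← y0] at q0
  rw [← y1] at q1
  rw [← y2] at q2
  rw [← hY, ← hu, ← hv]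
  have hd : dot Y Y = 1 := by
    simp only [dot, ← sq]
    rw [q0, q1, q2]
    field_simp
    ring
  have hs : planeTrace α' β' γ' Y = u + v := by
    simp only [planeTrace]
    rw [q0, q1, q2]
    field_simp
    ring
  have hm : planeDet α' β' γ' Y = u * v := by
    simp only [planeDet]
    rw [q0, q1, q2]
    field_simp
    ring
  obtain ⟨l1, l2⟩ := lam_unique (c2.trans c3) hs hm
  refine ⟨hd, l1, l2, fun i => ?_⟩
  fin_cases i
  · exact (congrArg SignType.sign y0).trans (sign_sign_mul_sqrt p1 z1.2)
  · exact (congrArg SignType.sign y1).trans (sign_sign_mul_sqrt p2 z2.2)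
  · exact (congrArg SignType.sign y2).trans (sign_sign_mul_sqrt p3 z3.2)

theorem eq_of_sq_eq_of_sign_eq {x y : ℝ} (h : x ^ 2 = y ^ 2)
    (hs : SignType.sign x = SignType.sign y) : x = y := by
  rw [← sign_mul_abs x, ← sign_mul_abs y, hs, (sq_eq_sq_iff_abs_eq_abs x y).1 h]

/-- A point of the unit sphere is determined by the two eigenvalues and the signs of its
coordinates. -/
theorem eq_of_lam_eq (h : Ordered α β γ) {X Y : Space} (hX : dot X X = 1) (hY : dot Y Y = 1)
    (hmax : lamMax α β γ X = lamMax α β γ Y) (hmin : lamMin α β γ X = lamMin α β γ Y)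
    (hs : ∀ i, SignType.sign (X i) = SignType.sign (Y i)) : X = Y := by
  have d1 : 0 < α - β := sub_pos.2 h.lt
  have d2 : 0 < β - γ := sub_pos.2 h.lt'
  have d3 : 0 < α - γ := by linarith
  refine space_ext (eq_of_sq_eq_of_sign_eq ?_ (hs 0)) (eq_of_sq_eq_of_sign_eq ?_ (hs 1))
    (eq_of_sq_eq_of_sign_eq ?_ (hs 2))
  · refine mul_right_cancel₀ (mul_pos d1 d3).ne' ?_
    rw [first_sq h.lt h.lt' hX, first_sq h.lt h.lt' hY, hmax, hmin]
  · refine mul_right_cancel₀ (mul_pos d1 d2).ne' ?_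
    rw [second_sq h.lt h.lt' hX, second_sq h.lt h.lt' hY, hmax, hmin]
  · refine mul_right_cancel₀ (mul_pos d3 d2).ne' ?_
    rw [third_sq h.lt h.lt' hX, third_sq h.lt h.lt' hY, hmax, hmin]

theorem sphereMap_sphereMap (h : Ordered α β γ) (h' : Ordered α' β' γ') {X : Space}
    (hX : dot X X = 1) :
    sphereMap α' β' γ' α β γ (sphereMap α β γ α' β' γ' X) = X := by
  obtain ⟨a1, a2, a3, a4⟩ := sphereMap_spec h h' hX
  obtain ⟨b1, b2, b3, b4⟩ := sphereMap_spec h' h a1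
  refine eq_of_lam_eq h b1 hX ?_ ?_ fun i => (b4 i).trans (a4 i)
  · rw [b2, a2, matchMap_matchMap h h']
  · rw [b3, a3, matchMap_matchMap h h']

theorem continuous_sphereMap (h : Ordered α β γ) :
    Continuous fun X : {X // dot X X = 1} => sphereMap α β γ α' β' γ' X := by
  have hu : Continuous fun X : {X // dot X X = 1} =>
      matchMap α β γ α' β' γ' (lamMax α β γ X) :=
    continuous_matchMap.comp (continuous_lamMax.comp continuous_subtype_val)
  have hv : Continuous fun X : {X // dot X X = 1} =>
      matchMap α β γ α' β' γ' (lamMin α β γ X) :=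
    continuous_matchMap.comp (continuous_lamMin.comp continuous_subtype_val)
  obtain ⟨-, vγ, vβ, vα⟩ := matchMap_values (α' := α') (β' := β') (γ' := γ') h
  refine continuous_pi fun i => ?_
  fin_cases i
  · refine continuous_sign_mul ((continuous_apply _).comp continuous_subtype_val) (by fun_prop) fun X hX => ?_
    have := first_sq h.lt h.lt' X.2
    rw [hX, zero_pow two_ne_zero, zero_mul, eq_comm, mul_eq_zero, sub_eq_zero, sub_eq_zero] at this
    rcases this with e | e <;> rw [← e, vα] <;> simp
  · refine continuous_sign_mul ((continuous_apply _).comp continuous_subtype_val) (by fun_prop) fun X hX => ?_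
    have := second_sq h.lt h.lt' X.2
    rw [hX, zero_pow two_ne_zero, zero_mul, eq_comm, mul_eq_zero, sub_eq_zero, sub_eq_zero] at this
    rcases this with e | e
    · rw [e, vβ]; simp
    · rw [← e, vβ]; simp
  · refine continuous_sign_mul ((continuous_apply _).comp continuous_subtype_val) (by fun_prop) fun X hX => ?_
    have := third_sq h.lt h.lt' X.2
    rw [hX, zero_pow two_ne_zero, zero_mul, eq_comm, mul_eq_zero, sub_eq_zero, sub_eq_zero] at this
    rcases this with e | e <;> rw [e, vγ] <;> simp

/-- `sphereMap` as a homeomorphism. -/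
def sphereHomeomorph (h : Ordered α β γ) (h' : Ordered α' β' γ') :
    {X : Space // dot X X = 1} ≃ₜ {X : Space // dot X X = 1} where
  toFun X := ⟨sphereMap α β γ α' β' γ' X, (sphereMap_spec h h' X.2).1⟩
  invFun X := ⟨sphereMap α' β' γ' α β γ X, (sphereMap_spec h' h X.2).1⟩
  left_inv X := Subtype.ext (sphereMap_sphereMap h h' X.2)
  right_inv X := Subtype.ext (sphereMap_sphereMap h' h X.2)
  continuous_toFun := (continuous_sphereMap h).subtype_mk _
  continuous_invFun := (continuous_sphereMap h').subtype_mk _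

end SphereMap

/-! ### The equivalence of principal configurations -/

namespace NormalForm

variable {φ φ' : Space → ℝ} {o o' : Space} {L L' : Space ≃L[ℝ] Space}
  {κ κ' α β γ α' β' γ' : ℝ}

theorem ordered (h : NormalForm φ o L κ α β γ) : Ordered α β γ := ⟨h.lt, h.pos, h.neg⟩

/-- The affine parametrization of the surface by the unit sphere. -/
def homeomorph (h : NormalForm φ o L κ α β γ) : {X : Space // dot X X = 1} ≃ₜ zeroSet φ :=
  (L.toHomeomorph.trans (Homeomorph.addLeft o)).subtype fun X => (h.mem_zeroSet X).symm

theorem mem_foliation (h : NormalForm φ o L κ α β γ) (i : Fin 2) (A : Set Space) :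
    A ∈ foliation φ i ↔ ∃ X ∈ regularSphere α β γ, A = leaf φ i (o + L X) := by
  constructor
  · rintro ⟨p, hp, rfl⟩
    obtain ⟨X, rfl⟩ := exists_eq o L p
    exact ⟨X, ((h.mem_leaf i X X).1 hp).1, rfl⟩
  · rintro ⟨X, hX, rfl⟩
    exact ⟨o + L X, (h.mem_leaf i X X).2 ⟨hX, hX, rfl, rfl⟩, rfl⟩

theorem principallyEquivalent (h : NormalForm φ o L κ α β γ)
    (h' : NormalForm φ' o' L' κ' α' β' γ') :
    PrincipallyEquivalent (principalConfiguration φ) (principalConfiguration φ') := by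
  set F : Space → Space := sphereMap α β γ α' β' γ' with hF
  set H : zeroSet φ ≃ₜ zeroSet φ' :=
    h.homeomorph.symm.trans ((sphereHomeomorph h.ordered h'.ordered).trans h'.homeomorph) with hH
  have hHF : ∀ X : {X : Space // dot X X = 1}, (H (h.homeomorph X) : Space) = o' + L' (F X) := by
    intro X
    simp only [hH, Homeomorph.trans_apply, Homeomorph.symm_apply_apply]
    rfl
  have hval : ∀ X : {X : Space // dot X X = 1}, (h.homeomorph X : Space) = o + L X :=
    fun X => rfl
  have hspec : ∀ {X}, dot X X = 1 → _ := fun {X} hX =>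
    sphereMap_spec h.ordered h'.ordered (X := X) hX
  -- Reduces each statement about sets on the surfaces to an equivalence on the unit sphere.
  have hmap : ∀ {A B : Set Space}, B ⊆ zeroSet φ' →
      (∀ X, dot X X = 1 → (o + L X ∈ A ↔ o' + L' (F X) ∈ B)) → mapSet H A = B := by
    intro A B hB hAB
    ext q
    constructor
    · rintro ⟨p, hp, rfl⟩
      obtain ⟨X, rfl⟩ := h.homeomorph.surjective p
      rw [hHF]
      exact (hAB X X.2).1 hp
    · intro hq
      obtain ⟨p, hp⟩ := H.surjective ⟨q, hB hq⟩
      obtain ⟨X, rfl⟩ := h.homeomorph.surjective p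
      have hq' : o' + L' (F X) = q := by rw [← hHF, hp]
      refine ⟨h.homeomorph X, ?_, by rw [hp]⟩
      rw [hval, hAB X X.2, hq']
      exact hq
  have hinj := matchMap_injective h.ordered h'.ordered
  have hzero := (matchMap_values (α' := α') (β' := β') (γ' := γ') h.ordered).1
  have hreg : ∀ {X}, dot X X = 1 → (X ∈ regularSphere α β γ ↔ F X ∈ regularSphere α' β' γ') := by
    intro X hX
    obtain ⟨a1, a2, a3, a4⟩ := hspec hX
    simp only [regularSphere, Set.mem_ofPred_eq, hF, a1, a2, a3, hX, true_and, ne_eq,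
      hinj.eq_iff]
  have hco : ∀ (i : Fin 2) {X}, dot X X = 1 → coeigval i α' β' γ' (F X)
      = matchMap α β γ α' β' γ' (coeigval i α β γ X) := by
    intro i X hX
    obtain ⟨a1, a2, a3, a4⟩ := hspec hX
    unfold coeigval
    split_ifs
    exacts [a2, a3]
  have hleaf : ∀ (i : Fin 2) (X : Space), dot X X = 1 →
      mapSet H (leaf φ i (o + L X)) = leaf φ' i (o' + L' (F X)) := by
    intro i X hX
    refine hmap ?_ fun Y hY => ?_
    · intro q hq
      obtain ⟨Y, rfl⟩ := exists_eq o' L' q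
      exact (h'.mem_zeroSet Y).2 ((h'.mem_leaf i _ Y).1 hq).2.1.1
    · rw [h.mem_leaf, h'.mem_leaf, ← hreg hX, ← hreg hY, hco i hX, hco i hY, hinj.eq_iff,
        (hspec hX).2.2.2, (hspec hY).2.2.2]
  have hfol : ∀ i : Fin 2, mapSet H '' foliation φ i = foliation φ' i := by
    intro i
    ext B
    rw [h'.mem_foliation]
    constructor
    · rintro ⟨A, hA, rfl⟩
      obtain ⟨X, hX, rfl⟩ := (h.mem_foliation i A).1 hA
      exact ⟨F X, (hreg hX.1).1 hX, hleaf i X hX.1⟩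
    · rintro ⟨Y, hY, rfl⟩
      obtain ⟨X, hX⟩ := (sphereHomeomorph h.ordered h'.ordered).surjective ⟨Y, hY.1⟩
      have hXY : F X = Y := congrArg Subtype.val hX
      refine ⟨leaf φ i (o + L X), (h.mem_foliation i _).2 ⟨X, ?_, rfl⟩, ?_⟩
      · rw [hreg X.2, hXY]; exact hY
      · rw [hleaf i X X.2, hXY]
  refine ⟨H, hfol 0, hfol 1, hmap (fun q hq => hq.1) fun X hX => ?_,
    hmap (fun q hq => hq.1) fun X hX => ?_, hmap (fun q hq => hq.1) fun X hX => ?_⟩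
  · obtain ⟨a1, a2, a3, a4⟩ := hspec hX
    change _ ∈ umbilicSet φ ↔ _ ∈ umbilicSet φ'
    rw [h.mem_umbilicSet, h'.mem_umbilicSet, hF, a1, a2, a3, hinj.eq_iff, hX]
  · obtain ⟨a1, a2, a3, a4⟩ := hspec hX
    change _ ∈ tropic φ ↔ _ ∈ tropic φ'
    rw [h.mem_tropic, h'.mem_tropic, hF, a1, a3, hX, ← hinj.eq_iff (a := lamMin α β γ X), hzero]
  · change _ ∈ lightlikePrincipalLocus φ ↔ _ ∈ lightlikePrincipalLocus φ'
    rw [h.lightlikePrincipalLocus_eq_empty, h'.lightlikePrincipalLocus_eq_empty]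
    exact Iff.rfl

end NormalForm

end

end Minkowski

theorem mainTheorem2 (Q₁ Q₂ : Minkowski.Quadric)
    (hE₁ : Q₁.IsEllipsoid) (hE₂ : Q₂.IsEllipsoid)
    (hA₁ : Q₁.HasThreeDistinctAxes) (hA₂ : Q₂.HasThreeDistinctAxes) :
    Minkowski.PrincipallyEquivalent
      (Minkowski.principalConfiguration Q₁.poly)
      (Minkowski.principalConfiguration Q₂.poly) := by
  obtain ⟨_, _, _, _, _, _, h₁⟩ := hE₁.exists_normalForm hA₁
  obtain ⟨_, _, _, _, _, _, h₂⟩ := hE₂.exists_normalForm hA₂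
  exact h₁.principallyEquivalent h₂
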